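/- For positive integers $n,p,k$ and reals $\tau,\sigma>0$, consider the linear regression model $$y_i=x_i^{T}\beta+\sigma z_i,\qquad i=1,\dots,n,$$ where $\beta\in\mathbb R^p$ is unknown, the covariates $x_1,\dots,x_n$ are i.i.d. $\mathcal N(0,\tfrac1n I_p)$, and the errors $z_1,\dots,z_n$ are i.i.d. $\mathcal N(0,1)$ and independent of the covariates. Let $\mathbb E_\beta$ denote expectation under this model, let $\|\beta\|_0$ be the number of non-zero coordinates of $\beta$, and put $$\Theta(k,\tau)=\{\beta\in\mathbb R^p:\ \|\beta\|_0\le k,\ \|\beta\|_2^2\le k\tau^2\},\qquad R(\Theta(k,\tau),\sigma)=\inf_{\hat\beta}\ \sup_{\beta\in\Theta(k,\tau)}\mathbb E_\beta\|\hat\beta-\beta\|_2^2,$$ the infimum being over all measurable functions $\hat\beta$ of the data $(x_i,y_i)_{i\le n}$ with values in $\mathbb R^p$. For $\lambda>0$ let $\hat\beta^{R}(\lambda)\in\arg\min_{b\in\mathbb R^p}\sum_{i=1}^n(y_i-x_i^Tb)^2+\lambda\|b\|_2^2$ be the ridge regression estimator. **Theorem.** Let $p=p_n\ge1$ and $k=k_n\ge1$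 be integers and $\tau=\tau_n>0$, $\sigma=\sigma_n>0$ reals such that, as $n\to\infty$, $k/p\to0$, $k/n\to0$ and $\tau/\sigma\to0$. Then, as $n\to\infty$, $$R(\Theta(k,\tau),\sigma)=k\tau^2\Big(1-\frac{k\tau^2}{p\sigma^2}\,(1+o(1))\Big).$$ Moreover, with $\lambda=p\sigma^2/(k\tau^2)$, the ridge estimator attains this second-order expansion: $$\sup_{\beta\in\Theta(k,\tau)}\mathbb E_\beta\|\hat\beta^{R}(\lambda)-\beta\|_2^2=k\tau^2\Big(1-\frac{k\tau^2}{p\sigma^2}\,(1+o(1))\Big).$$ -/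

import Mathlib

open MeasureTheory ProbabilityTheory Filter Topology
open scoped ENNReal NNReal Matrix

namespace SparseRegression

/-- An observed data set `(X, y)`: the rows `x_1, …, x_n ∈ ℝ^p` of the design and the
responses `y_1, …, y_n`. -/
abbrev Data (n p : ℕ) : Type := (Fin n → Fin p → ℝ) × (Fin n → ℝ)

/-- An estimator of `β ∈ ℝ^p`: a function of the data (measurability is imposed separately). -/
abbrev Estimator (n p : ℕ) : Type := Data n p → EuclideanSpace ℝ (Fin p)

/-- The law of the design: the rows `x_1, …, x_n` are i.i.d. `N(0, (1/n) I_p)`, that is, all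
entries are i.i.d. `N(0, 1/n)`. -/
noncomputable def designLaw (n p : ℕ) : Measure (Fin n → Fin p → ℝ) :=
  Measure.pi fun _ => Measure.pi fun _ => gaussianReal 0 ((n : ℝ≥0)⁻¹)

/-- The law of the errors `z_1, …, z_n`: i.i.d. `N(0, 1)`. -/
noncomputable def noiseLaw (n : ℕ) : Measure (Fin n → ℝ) :=
  Measure.pi fun _ => gaussianReal 0 1

/-- The responses `y_i = x_iᵀ β + σ z_i`. -/
noncomputable def response {n p : ℕ} (σ : ℝ) (β : EuclideanSpace ℝ (Fin p))
    (X : Fin n → Fin p → ℝ) (z : Fin n → ℝ) : Fin n → ℝ :=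
  fun i => X i ⬝ᵥ β.ofLp + σ * z i

/-- The mean squared error `E_β ‖β̂ - β‖₂²` (possibly infinite), the design and the errors being
independent. -/
noncomputable def risk {n p : ℕ} (σ : ℝ) (est : Estimator n p)
    (β : EuclideanSpace ℝ (Fin p)) : ℝ≥0∞ :=
  ∫⁻ ω, ‖est (ω.1, response σ β ω.1 ω.2) - β‖ₑ ^ 2 ∂((designLaw n p).prod (noiseLaw n))

/-- The parameter space `Θ(k, τ) = {β ∈ ℝ^p : ‖β‖₀ ≤ k, ‖β‖₂² ≤ k τ²}`. -/
def paramSpace (p k : ℕ) (τ : ℝ) : Set (EuclideanSpace ℝ (Fin p)) :=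
  {β | hammingNorm β.ofLp ≤ k ∧ ‖β‖ ^ 2 ≤ k * τ ^ 2}

/-- The worst-case risk of an estimator over `Θ(k, τ)`. -/
noncomputable def supRisk {n p : ℕ} (k : ℕ) (τ σ : ℝ) (est : Estimator n p) : ℝ≥0∞ :=
  ⨆ β ∈ paramSpace p k τ, risk σ est β

/-- The minimax risk `R(Θ(k, τ), σ)`: the infimum, over all measurable (non-randomized)
estimators, of the
worst-case risk. -/
noncomputable def snrMinimaxRisk (n p k : ℕ) (τ σ : ℝ) : ℝ≥0∞ :=
  ⨅ (est : Estimator n p) (_ : Measurable est), supRisk k τ σ est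

/-- The ridge objective `∑_i (y_i - x_iᵀ b)² + lam ‖b‖₂²`. -/
noncomputable def ridgeObjective {n p : ℕ} (lam : ℝ) (D : Data n p)
    (b : EuclideanSpace ℝ (Fin p)) : ℝ :=
  (∑ i, (D.2 i - D.1 i ⬝ᵥ b.ofLp) ^ 2) + lam * ‖b‖ ^ 2

/-- `est` is a ridge estimator with tuning `lam`: on every data set its value minimizes the ridge
objective over `ℝ^p`. -/
def IsRidgeEstimator {n p : ℕ} (lam : ℝ) (est : Estimator n p) : Prop :=
  ∀ D : Data n p, IsMinOn (ridgeObjective lam D) Set.univ (est D)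

end SparseRegression

/-! Both expansions come from one sandwich. Put `r = kτ²/(pσ²)`, `a = (τ/σ)²`. The minimax risk lies
between a Bayes risk and the worst-case risk of ridge, and both bounds are `kτ²(1 - r(1 + o(1)))`.

Upper bound. With `G = XᵀX` and `λ = 1/r`, the ridge error is a bias `-λ(G + λ)⁻¹β` plus noise `σ(G
+ λ)⁻¹Xᵀz`. Expanding in `1/λ`, the squared bias is at most `‖β‖² - (2/λ)⟨Gβ,β⟩ + (3/λ²)‖Gβ‖²`, and
the squared noise at most `σ²‖Xᵀz‖²/λ²`; the cross term disappears on averaging over `±z`. Since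
`E⟨Gβ,β⟩ = ‖β‖²`, `E‖Gβ‖² ≤ (1 + Kp/n)‖β‖²` and `E‖Xᵀz‖² = p`, the first-order terms are `-2r + r =
-r`, while the rest is `3r²(1 + Kp/n)` with `rp/n = (k/n)a → 0` (`risk_ridgeEstimator_le`,
`supRisk_ridgeEstimator_le`).

Lower bound. Cut `km` coordinates, `m = ⌊p/k⌋`, into `k` blocks and put `±τ` at a uniform position
of each block independently. Even with the other blocks known, one block has `2m` hypotheses, each a
shift of Gaussian noise. By Cameron–Martin the Bayes risk is an integral of a quadratic in the
estimate; minimizing it leaves `τ²` minus a second moment of likelihood-ratio differences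
(`block_bayesRisk_ge`). Averaging over the design turns this into chi-square exponential moments,
giving `kτ²(1 - infoBound a / m)` (`supRisk_ge`), where `infoBound a ~ a` and `m ~ p/k`. -/

namespace SparseRegression

/-! ### Moments, exponential moments and shifts of Gaussian vectors. -/

section Gaussian

variable {ι : Type*} [Fintype ι]

@[fun_prop]
lemma measurable_dotProduct {α : Type*} [MeasurableSpace α] {f g : α → ι → ℝ}
    (hf : Measurable f) (hg : Measurable g) : Measurable fun a => f a ⬝ᵥ g a := by
  unfold dotProduct
  exact Finset.measurable_sum _ fun i _ =>
    ((measurable_pi_apply i).comp hf).mul ((measurable_pi_apply i).comp hg)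

/-- A sum of independent Gaussians is Gaussian, so its mean and variance identify it. All moments of
linear forms below are read off from this law. -/
lemma map_dotProduct_pi_gaussianReal (v : ℝ≥0) (w : ι → ℝ) :
    (Measure.pi fun _ : ι => gaussianReal 0 v).map (fun x => x ⬝ᵥ w) =
      gaussianReal 0 (v * (w ⬝ᵥ w).toNNReal) := by
  have hmp : ∀ i, MemLp (fun x : ℝ => x * w i) 2 (gaussianReal 0 v) := fun i =>
    (memLp_id_gaussianReal 2).mul_const (w i)
  have hlaw : ∀ i, HasLaw (fun x : ι → ℝ => x i * w i) (gaussianReal 0 (.mk (w i ^ 2) (sq_nonneg _) * v))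
      (Measure.pi fun _ : ι => gaussianReal 0 v) := by
    intro i
    have h : HasLaw (fun x : ι → ℝ => x i) (gaussianReal 0 v)
      (Measure.pi fun _ : ι => gaussianReal 0 v) :=
      ⟨(measurable_pi_apply i).aemeasurable, (measurePreserving_eval _ i).map_eq⟩
    simpa using gaussianReal_mul_const h (w i)
  have hg : HasGaussianLaw (fun x : ι → ℝ => x ⬝ᵥ w) (Measure.pi fun _ : ι => gaussianReal 0 v) := by
    refine iIndepFun.hasGaussianLaw_fun_sum (X := fun i (x : ι → ℝ) => x i * w i)
      (fun i => (hlaw i).hasGaussianLaw) ?_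
    exact iIndepFun_pi (X := fun i (x : ℝ) => x * w i) (fun i => by fun_prop)
  rw [hg.map_eq_gaussianReal]
  have h1 : ∫ x : ι → ℝ, x ⬝ᵥ w ∂(Measure.pi fun _ : ι => gaussianReal 0 v) = 0 := by
    simp only [dotProduct]
    rw [integral_finsetSum]
    · refine Finset.sum_eq_zero fun i _ => ?_
      rw [(hlaw i).integral_eq]; simp
    · intro i _
      exact (integrable_comp_eval (μ := fun _ : ι => gaussianReal 0 v)
        (f := fun x : ℝ => x * w i) ((hmp i).integrable one_le_two))
  have h2 : Var[fun x : ι → ℝ => x ⬝ᵥ w; Measure.pi fun _ : ι => gaussianReal 0 v] =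
      v * (w ⬝ᵥ w) := by
    have : (fun x : ι → ℝ => x ⬝ᵥ w) = ∑ i, fun x : ι → ℝ => (fun y : ℝ => y * w i) (x i) := by
      ext x; simp [dotProduct]
    rw [this, variance_sum_pi (X := fun i (y : ℝ) => y * w i) hmp]
    simp only [variance_mul_const]
    simp only [variance_fun_id_gaussianReal, dotProduct, Finset.mul_sum]
    exact Finset.sum_congr rfl fun i _ => by ring
  rw [h1, h2]
  congr 1
  rw [Real.toNNReal_mul v.coe_nonneg, Real.toNNReal_coe]

lemma hasLaw_dotProduct_pi_gaussianReal (v : ℝ≥0) (w : ι → ℝ) :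
    HasLaw (fun x : ι → ℝ => x ⬝ᵥ w) (gaussianReal 0 (v * (w ⬝ᵥ w).toNNReal))
      (Measure.pi fun _ : ι => gaussianReal 0 v) :=
  ⟨Measurable.aemeasurable (by fun_prop), map_dotProduct_pi_gaussianReal v w⟩

lemma dotProduct_self_nonneg' (w : ι → ℝ) : 0 ≤ w ⬝ᵥ w :=
  Finset.sum_nonneg fun i _ => mul_self_nonneg (w i)

lemma memLp_dotProduct_pi_gaussianReal (v : ℝ≥0) (w : ι → ℝ) (q : ℝ≥0) :
    MemLp (fun x : ι → ℝ => x ⬝ᵥ w) q (Measure.pi fun _ : ι => gaussianReal 0 v) := by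
  have h := memLp_id_gaussianReal (μ := 0) (v := v * (w ⬝ᵥ w).toNNReal) q
  rw [← map_dotProduct_pi_gaussianReal v w,
    memLp_map_measure_iff (Measurable.aestronglyMeasurable (by fun_prop)) (Measurable.aemeasurable (by fun_prop))] at h
  exact h

lemma integral_dotProduct_pi_gaussianReal (v : ℝ≥0) (w : ι → ℝ) :
    ∫ x, x ⬝ᵥ w ∂(Measure.pi fun _ : ι => gaussianReal 0 v) = 0 := by
  rw [(hasLaw_dotProduct_pi_gaussianReal v w).integral_eq]; simp

lemma integral_dotProduct_sq_pi_gaussianReal (v : ℝ≥0) (w : ι → ℝ) :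
    ∫ x, (x ⬝ᵥ w) ^ 2 ∂(Measure.pi fun _ : ι => gaussianReal 0 v) = v * (w ⬝ᵥ w) := by
  have h := (hasLaw_dotProduct_pi_gaussianReal v w).variance_eq
  rw [variance_id_gaussianReal, variance_of_integral_eq_zero
    (Measurable.aemeasurable (by fun_prop)) (integral_dotProduct_pi_gaussianReal v w)] at h
  rw [h]
  simp [dotProduct_self_nonneg' w]

lemma integral_pow_four_gaussianReal (v : ℝ≥0) :
    ∫ x, x ^ 4 ∂(gaussianReal 0 v) = v ^ 2 * ∫ x, x ^ 4 ∂(gaussianReal 0 1) := by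
  have h := gaussianReal_map_const_mul (μ := 0) (v := 1) (Real.sqrt v)
  have hv : (NNReal.mk (√(v : ℝ) ^ 2) (sq_nonneg _)) * 1 = v := by
    ext; simp
  rw [mul_zero, hv] at h
  rw [← h, integral_map (by fun_prop) (by fun_prop), ← integral_const_mul]
  congr 1
  ext x
  rw [mul_pow]
  congr 1
  rw [show (4 : ℕ) = 2 * 2 by norm_num, pow_mul, Real.sq_sqrt v.coe_nonneg]

lemma integral_dotProduct_pow_four_pi_gaussianReal (v : ℝ≥0) (w : ι → ℝ) :
    ∫ x, (x ⬝ᵥ w) ^ 4 ∂(Measure.pi fun _ : ι => gaussianReal 0 v) =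
      v ^ 2 * (w ⬝ᵥ w) ^ 2 * ∫ x, x ^ 4 ∂(gaussianReal 0 1) := by
  have h := (hasLaw_dotProduct_pi_gaussianReal v w).integral_comp (f := fun x => x ^ 4)
    (by fun_prop)
  simp only [Function.comp_def] at h
  rw [h, integral_pow_four_gaussianReal]
  simp [dotProduct_self_nonneg' w, mul_pow]

/-- The covariance of two linear forms of a standard Gaussian vector. -/
lemma integral_dotProduct_mul_dotProduct_pi_gaussianReal (v : ℝ≥0) (w w' : ι → ℝ) :
    ∫ x, (x ⬝ᵥ w) * (x ⬝ᵥ w') ∂(Measure.pi fun _ : ι => gaussianReal 0 v) =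
      v * (w ⬝ᵥ w') := by
  have h1 := integral_dotProduct_sq_pi_gaussianReal v (w + w')
  have h2 := integral_dotProduct_sq_pi_gaussianReal v (w - w')
  have i1 := (memLp_dotProduct_pi_gaussianReal v (w + w') 2).integrable_sq
  have i2 := (memLp_dotProduct_pi_gaussianReal v (w - w') 2).integrable_sq
  have : ∀ x : ι → ℝ, (x ⬝ᵥ w) * (x ⬝ᵥ w') =
      (1 / 4) * ((x ⬝ᵥ (w + w')) ^ 2 - (x ⬝ᵥ (w - w')) ^ 2) := by
    intro x; simp only [dotProduct_add, dotProduct_sub]; ring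
  simp only [this]
  rw [integral_const_mul, integral_sub i1 i2, h1, h2]
  simp only [dotProduct_add, dotProduct_sub, add_dotProduct, sub_dotProduct]
  rw [dotProduct_comm w' w]; ring

lemma integral_exp_dotProduct_pi_gaussianReal (w : ι → ℝ) :
    ∫ x, Real.exp (x ⬝ᵥ w) ∂(Measure.pi fun _ : ι => gaussianReal 0 1) =
      Real.exp (w ⬝ᵥ w / 2) := by
  have h := mgf_gaussianReal (map_dotProduct_pi_gaussianReal 1 w) 1
  simp only [mgf, one_mul] at h
  rw [h]
  simp [dotProduct_self_nonneg' w]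

lemma integrable_exp_dotProduct_pi_gaussianReal (w : ι → ℝ) :
    Integrable (fun x => Real.exp (x ⬝ᵥ w)) (Measure.pi fun _ : ι => gaussianReal 0 1) := by
  have h := integrable_exp_mul_gaussianReal (μ := 0) (v := 1 * (w ⬝ᵥ w).toNNReal) 1
  rw [← map_dotProduct_pi_gaussianReal 1 w, integrable_map_measure
    (Measurable.aestronglyMeasurable (by fun_prop)) (Measurable.aemeasurable (by fun_prop))] at h
  simpa [Function.comp_def] using h

lemma gaussianReal_eq_withDensity_standard (w : ℝ) :
    gaussianReal w 1 =
      (gaussianReal 0 1).withDensity fun z => ENNReal.ofReal (Real.exp (z * w - w ^ 2 / 2)) := by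
  rw [gaussianReal_of_var_ne_zero _ one_ne_zero, gaussianReal_of_var_ne_zero _ one_ne_zero,
    ← withDensity_mul _ (measurable_gaussianPDF _ _) (by fun_prop)]
  congr 1
  ext z
  simp only [Pi.mul_apply, gaussianPDF, gaussianPDFReal]
  rw [← ENNReal.ofReal_mul (by positivity), mul_assoc _ (Real.exp _), ← Real.exp_add]
  congr 3
  simp; ring

/-- The Cameron–Martin formula for a standard Gaussian vector. -/
lemma lintegral_add_pi_gaussianReal (w : ι → ℝ) {F : (ι → ℝ) → ℝ≥0∞} (hF : Measurable F) :
    ∫⁻ z, F (z + w) ∂(Measure.pi fun _ : ι => gaussianReal 0 1) =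
      ∫⁻ z, ENNReal.ofReal (Real.exp (z ⬝ᵥ w - w ⬝ᵥ w / 2)) * F z
        ∂(Measure.pi fun _ : ι => gaussianReal 0 1) := by
  set μ : Measure (ι → ℝ) := Measure.pi fun _ : ι => gaussianReal 0 1 with hμ
  let g : ι → ℝ → ℝ≥0∞ := fun i z => ENNReal.ofReal (Real.exp (z * w i - w i ^ 2 / 2))
  have hprod : ∀ z : ι → ℝ,
      ENNReal.ofReal (Real.exp (z ⬝ᵥ w - w ⬝ᵥ w / 2)) = ∏ i, g i (z i) := by
    intro z
    simp only [g]
    rw [← ENNReal.ofReal_prod_of_nonneg (fun _ _ => (Real.exp_pos _).le), ← Real.exp_sum]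
    simp only [dotProduct, Finset.sum_sub_distrib, Finset.sum_div, pow_two]
  have hgm : ∀ i, Measurable (g i) := fun i => by fun_prop
  -- It suffices to compare on boxes, where the indicator times the product density factorizes over
  -- independent coordinates.
  have hpi : (Measure.pi fun i => gaussianReal (w i) 1) = μ.withDensity fun z => ∏ i, g i (z i) := by
    refine Measure.pi_eq fun s hs => ?_
    have hms : MeasurableSet (Set.univ.pi s) := MeasurableSet.univ_pi hs
    rw [withDensity_apply _ hms, ← lintegral_indicator hms]
    have : ∀ z : ι → ℝ, (Set.univ.pi s).indicator (fun z => ∏ i, g i (z i)) z =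
        ∏ i, (s i).indicator (g i) (z i) := by
      intro z
      by_cases hz : z ∈ Set.univ.pi s
      · rw [Set.indicator_of_mem hz]
        exact Finset.prod_congr rfl fun i _ => (Set.indicator_of_mem (hz i trivial) _).symm
      · rw [Set.indicator_of_notMem hz]
        simp only [Set.mem_pi, Set.mem_univ, true_implies, not_forall] at hz
        obtain ⟨i, hi⟩ := hz
        exact (Finset.prod_eq_zero (Finset.mem_univ i) (Set.indicator_of_notMem hi _)).symm
    simp only [this]
    rw [lintegral_prod_eq_prod_lintegral_of_indepFun Finset.univ
      (fun i (z : ι → ℝ) => (s i).indicator (g i) (z i))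
      (iIndepFun_pi fun i => ((hgm i).indicator (hs i)).aemeasurable)
      (fun i => ((hgm i).indicator (hs i)).comp (measurable_pi_apply i))]
    refine Finset.prod_congr rfl fun i _ => ?_
    rw [(measurePreserving_eval (fun _ : ι => gaussianReal 0 1) i).lintegral_comp
      ((hgm i).indicator (hs i)), lintegral_indicator (hs i),
      gaussianReal_eq_withDensity_standard (w i), withDensity_apply _ (hs i)]
  have hmap : μ.map (fun z => z + w) = Measure.pi fun i => gaussianReal (w i) 1 := by
    have : (fun z : ι → ℝ => z + w) = fun z i => z i + w i := rfl
    rw [this, hμ, Measure.pi_map_pi (f := fun i (z : ℝ) => z + w i) (fun i => by fun_prop)]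
    congr 1
    ext1 i
    rw [gaussianReal_map_add_const, zero_add]
  rw [← lintegral_map hF (by fun_prop), hmap, hpi, lintegral_withDensity_eq_lintegral_mul _
    (by fun_prop) hF]
  simp only [Pi.mul_apply, hprod]

lemma measurePreserving_neg_pi_gaussianReal (v : ℝ≥0) :
    MeasurePreserving (fun z : ι → ℝ => -z) (Measure.pi fun _ : ι => gaussianReal 0 v)
      (Measure.pi fun _ : ι => gaussianReal 0 v) := by
  refine ⟨by fun_prop, ?_⟩
  have : (fun z : ι → ℝ => -z) = fun z i => -z i := rfl
  rw [this, Measure.pi_map_pi (f := fun _ (z : ℝ) => -z) (fun i => by fun_prop)]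
  congr 1
  ext1 i
  rw [gaussianReal_map_neg, neg_zero]

/-- The weight merges with the density into an unnormalized centred Gaussian, integrable exactly
because `2tv < 1`. -/
lemma integral_exp_mul_sq_gaussianReal {v : ℝ≥0} (hv : v ≠ 0) {t : ℝ} (ht : 2 * t * v < 1) :
    Integrable (fun x => Real.exp (t * x ^ 2)) (gaussianReal 0 v) ∧
    ∫ x, Real.exp (t * x ^ 2) ∂(gaussianReal 0 v) = (√(1 - 2 * t * v))⁻¹ := by
  have hv0 : (0 : ℝ) < v := by positivity
  have hb : 0 < (1 - 2 * t * v) / (2 * v) := div_pos (by linarith) (by positivity)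
  have key : ∀ x : ℝ, gaussianPDFReal 0 v x * Real.exp (t * x ^ 2) =
      (√(2 * Real.pi * v))⁻¹ * Real.exp (-((1 - 2 * t * v) / (2 * v)) * x ^ 2) := by
    intro x
    rw [gaussianPDFReal, mul_assoc, ← Real.exp_add]
    congr 2
    field_simp; ring
  constructor
  · rw [gaussianReal_of_var_ne_zero _ hv, gaussianPDF_def,
      integrable_withDensity_iff_integrable_smul' (by fun_prop) (by simp)]
    simp only [ENNReal.toReal_ofReal (gaussianPDFReal_nonneg _ _ _), smul_eq_mul, key]
    exact (integrable_exp_neg_mul_sq hb).const_mul _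
  · rw [integral_gaussianReal_eq_integral_smul hv]
    simp only [smul_eq_mul, key]
    rw [integral_const_mul, integral_gaussian, ← Real.sqrt_inv, ← Real.sqrt_inv,
      ← Real.sqrt_mul (by positivity)]
    congr 1
    have := Real.pi_pos
    have h1 : 1 - 2 * t * v ≠ 0 := by linarith
    field_simp

lemma integral_exp_mul_sq_sum_pi_gaussianReal {v : ℝ≥0} (hv : v ≠ 0) {t : ℝ}
    (ht : 2 * t * v < 1) :
    Integrable (fun x : ι → ℝ => Real.exp (t * (x ⬝ᵥ x)))
      (Measure.pi fun _ : ι => gaussianReal 0 v) ∧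
    ∫ x, Real.exp (t * (x ⬝ᵥ x)) ∂(Measure.pi fun _ : ι => gaussianReal 0 v) =
      (√(1 - 2 * t * v))⁻¹ ^ Fintype.card ι := by
  have h : ∀ x : ι → ℝ, Real.exp (t * (x ⬝ᵥ x)) = ∏ i, Real.exp (t * x i ^ 2) := by
    intro x
    rw [← Real.exp_sum, dotProduct, Finset.mul_sum]
    simp only [pow_two]
  simp only [h]
  obtain ⟨h1, h2⟩ := integral_exp_mul_sq_gaussianReal hv ht
  refine ⟨Integrable.fintype_prod fun _ => h1, ?_⟩
  rw [integral_fintype_prod_eq_pow (fun x => Real.exp (t * x ^ 2)), h2]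

end Gaussian

/-! ### Deterministic bounds for `(G + λ)⁻¹` with `G` symmetric and nonnegative. -/

section Resolvent

variable {E : Type*} [NormedAddCommGroup E] [InnerProductSpace ℝ E] {G : E →ₗ[ℝ] E} {lam : ℝ}

open scoped InnerProductSpace

/-- Pair the equation with `d` and drop `⟪G d, d⟫ ≥ 0`. -/
lemma norm_sq_le_of_add_smul_eq (hG : ∀ x, 0 ≤ ⟪G x, x⟫_ℝ) (hlam : 0 < lam) {d q : E}
    (h : G d + lam • d = q) : ‖d‖ ^ 2 ≤ ‖q‖ ^ 2 / lam ^ 2 := by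
  have h1 : ⟪q, d⟫_ℝ = ⟪G d, d⟫_ℝ + lam * ‖d‖ ^ 2 := by
    rw [← h, inner_add_left, real_inner_smul_left, real_inner_self_eq_norm_sq]
  have h2 := real_inner_le_norm q d
  have h3 : lam * ‖d‖ ≤ ‖q‖ := by
    by_cases hd : ‖d‖ = 0
    · rw [hd, mul_zero]; exact norm_nonneg q
    · have : 0 < ‖d‖ := lt_of_le_of_ne (norm_nonneg d) (Ne.symm hd)
      refine le_of_mul_le_mul_right ?_ this
      nlinarith [hG d]
  rw [le_div_iff₀ (by positivity), ← mul_pow, mul_comm]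
  gcongr

/-- Write `v = β - w`, so that `w = (G + λ)⁻¹Gβ` is `Gβ/λ` to first order. In `‖β‖² - 2⟪β, w⟫ +
‖w‖²` the middle term costs two second-order remainders and the last term one, whence the constant
3. -/
lemma norm_sq_le_of_shrinkage (hs : ∀ x y, ⟪G x, y⟫_ℝ = ⟪x, G y⟫_ℝ) (hG : ∀ x, 0 ≤ ⟪G x, x⟫_ℝ)
    (hlam : 0 < lam) {v β : E} (h : G v + lam • v = lam • β) :
    ‖v‖ ^ 2 ≤ ‖β‖ ^ 2 - 2 / lam * ⟪G β, β⟫_ℝ + 3 / lam ^ 2 * ‖G β‖ ^ 2 := by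
  obtain ⟨w, rfl⟩ : ∃ w, v = β - w := ⟨β - v, by abel⟩
  have hw1 : lam • w = G (β - w) := by
    rw [smul_sub] at h
    exact (eq_of_sub_eq_zero (by rw [← sub_eq_zero_of_eq h]; abel)).symm
  have hw2 : G w + lam • w = G β := by rw [hw1, map_sub]; abel
  have h1 := norm_sq_le_of_add_smul_eq hG hlam hw2
  have h2 : lam * ⟪β, w⟫_ℝ = ⟪G β, β⟫_ℝ - ⟪G β, w⟫_ℝ := by
    rw [← real_inner_smul_right, hw1, ← hs, inner_sub_right]
  have h3 : ⟪G β, w⟫_ℝ ≤ ‖G β‖ ^ 2 / lam := by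
    have hn : ‖w‖ ≤ ‖G β‖ / lam := by
      rw [← div_pow] at h1
      exact le_of_sq_le_sq h1 (by positivity)
    calc ⟪G β, w⟫_ℝ ≤ ‖G β‖ * ‖w‖ := real_inner_le_norm _ _
      _ ≤ ‖G β‖ * (‖G β‖ / lam) := by gcongr
      _ = _ := by ring
  have h4 : 1 / lam * ⟪G β, β⟫_ℝ - ‖G β‖ ^ 2 / lam ^ 2 ≤ ⟪β, w⟫_ℝ := by
    have : ⟪β, w⟫_ℝ = (⟪G β, β⟫_ℝ - ⟪G β, w⟫_ℝ) / lam := by rw [← h2]; field_simp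
    rw [this, sub_div, one_div_mul_eq_div, pow_two lam, ← div_div]
    gcongr
  have h5 : ‖β - w‖ ^ 2 = ‖β‖ ^ 2 - 2 * ⟪β, w⟫_ℝ + ‖w‖ ^ 2 := norm_sub_sq_real β w
  have h6 : 2 / lam * ⟪G β, β⟫_ℝ = 2 * (1 / lam * ⟪G β, β⟫_ℝ) := by ring
  have h7 : 3 / lam ^ 2 * ‖G β‖ ^ 2 = 3 * (‖G β‖ ^ 2 / lam ^ 2) := by ring
  rw [h5, h6, h7]
  linarith

/-- The errors at noise `q` and `-q` have half-sum equal to the pure bias and half-difference equal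
to the pure noise part; the parallelogram law removes the cross term. -/
lemma norm_sq_add_norm_sq_le (hs : ∀ x y, ⟪G x, y⟫_ℝ = ⟪x, G y⟫_ℝ) (hG : ∀ x, 0 ≤ ⟪G x, x⟫_ℝ)
    (hlam : 0 < lam) {e₁ e₂ β q : E} (h₁ : G e₁ + lam • e₁ = q - lam • β)
    (h₂ : G e₂ + lam • e₂ = -q - lam • β) :
    ‖e₁‖ ^ 2 + ‖e₂‖ ^ 2 ≤ 2 * (‖β‖ ^ 2 - 2 / lam * ⟪G β, β⟫_ℝ + 3 / lam ^ 2 * ‖G β‖ ^ 2 +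
      1 / lam ^ 2 * ‖q‖ ^ 2) := by
  have hv := norm_sq_le_of_shrinkage hs hG hlam (v := (-(1 / 2 : ℝ)) • (e₁ + e₂)) (β := β) (by
    have : G (e₁ + e₂) + lam • (e₁ + e₂) = (-2 : ℝ) • lam • β := by
      rw [map_add, smul_add, add_add_add_comm, h₁, h₂, neg_smul, two_smul]; abel
    rw [map_smul, smul_comm lam, ← smul_add, this, smul_smul]; norm_num)
  have hd := norm_sq_le_of_add_smul_eq hG hlam (d := (1 / 2 : ℝ) • (e₁ - e₂)) (q := q) (by
    have : G (e₁ - e₂) + lam • (e₁ - e₂) = (2 : ℝ) • q := by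
      rw [map_sub, smul_sub, sub_add_sub_comm, h₁, h₂, two_smul]; abel
    rw [map_smul, smul_comm lam, ← smul_add, this, smul_smul]; norm_num)
  rw [norm_smul, mul_pow] at hv hd
  norm_num at hv hd
  have := parallelogram_law_with_norm ℝ e₁ e₂
  rw [one_div_mul_eq_div]
  nlinarith

end Resolvent

/-! ### Normal equations, existence, uniqueness and measurability of ridge. -/

section Ridge

variable {n p : ℕ}

/-- The Gram operator `b ↦ Xᵀ X b`. -/
noncomputable def gram (X : Fin n → Fin p → ℝ) :
    EuclideanSpace ℝ (Fin p) →ₗ[ℝ] EuclideanSpace ℝ (Fin p) :=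
  Matrix.toEuclideanLin ((Matrix.of X)ᵀ * Matrix.of X)

/-- The vector of inner products `Xᵀ y`. -/
noncomputable def score (X : Fin n → Fin p → ℝ) (y : Fin n → ℝ) : EuclideanSpace ℝ (Fin p) :=
  WithLp.toLp 2 ((Matrix.of X)ᵀ *ᵥ y)

lemma gram_apply (X : Fin n → Fin p → ℝ) (b : EuclideanSpace ℝ (Fin p)) :
    gram X b = score X (fun i => X i ⬝ᵥ b.ofLp) := by
  ext j
  simp only [gram, score, Matrix.toLpLin_apply, ← Matrix.mulVec_mulVec]
  rfl

lemma score_apply (X : Fin n → Fin p → ℝ) (y : Fin n → ℝ) (j : Fin p) :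
    (score X y).ofLp j = ∑ i, X i j * y i := by
  simp [score, Matrix.mulVec, dotProduct]

lemma inner_score (X : Fin n → Fin p → ℝ) (y : Fin n → ℝ) (b : EuclideanSpace ℝ (Fin p)) :
    inner ℝ (score X y) b = ∑ i, y i * (X i ⬝ᵥ b.ofLp) := by
  simp only [PiLp.inner_apply, score_apply, RCLike.inner_apply, conj_trivial, dotProduct,
    Finset.mul_sum]
  rw [Finset.sum_comm]
  exact Finset.sum_congr rfl fun i _ => Finset.sum_congr rfl fun j _ => by ring

lemma inner_gram (X : Fin n → Fin p → ℝ) (b c : EuclideanSpace ℝ (Fin p)) :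
    inner ℝ (gram X b) c = ∑ i, (X i ⬝ᵥ b.ofLp) * (X i ⬝ᵥ c.ofLp) := by
  rw [gram_apply, inner_score]

lemma gram_symm (X : Fin n → Fin p → ℝ) (b c : EuclideanSpace ℝ (Fin p)) :
    inner ℝ (gram X b) c = inner ℝ b (gram X c) := by
  rw [real_inner_comm _ b, inner_gram, inner_gram]
  exact Finset.sum_congr rfl fun i _ => mul_comm _ _

lemma gram_nonneg (X : Fin n → Fin p → ℝ) (b : EuclideanSpace ℝ (Fin p)) :
    0 ≤ inner ℝ (gram X b) b := by
  rw [inner_gram]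
  exact Finset.sum_nonneg fun i _ => mul_self_nonneg _

lemma score_add (X : Fin n → Fin p → ℝ) (y y' : Fin n → ℝ) :
    score X (y + y') = score X y + score X y' := by
  simp [score, Matrix.mulVec_add]

lemma score_smul (X : Fin n → Fin p → ℝ) (c : ℝ) (y : Fin n → ℝ) :
    score X (c • y) = c • score X y := by
  simp [score, Matrix.mulVec_smul]

/-- The objective is quadratic, so its Taylor expansion at `b` is exact; minimality becomes the
vanishing of the linear term. -/
lemma ridgeObjective_add (lam : ℝ) (D : Data n p) (b h : EuclideanSpace ℝ (Fin p)) :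
    ridgeObjective lam D (b + h) = ridgeObjective lam D b
      - 2 * inner ℝ (score D.1 D.2 - (gram D.1 b + lam • b)) h
      + (inner ℝ (gram D.1 h) h + lam * ‖h‖ ^ 2) := by
  simp only [ridgeObjective, inner_sub_left, inner_add_left, inner_score, inner_gram,
    real_inner_smul_left, norm_add_sq_real, WithLp.ofLp_add, dotProduct_add]
  have : ∀ i, (D.2 i - (D.1 i ⬝ᵥ b.ofLp + D.1 i ⬝ᵥ h.ofLp)) ^ 2 =
      (D.2 i - D.1 i ⬝ᵥ b.ofLp) ^ 2 - 2 * (D.2 i * (D.1 i ⬝ᵥ h.ofLp)) +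
        2 * ((D.1 i ⬝ᵥ b.ofLp) * (D.1 i ⬝ᵥ h.ofLp)) + (D.1 i ⬝ᵥ h.ofLp) * (D.1 i ⬝ᵥ h.ofLp) :=
    fun i => by ring
  simp only [this, Finset.sum_add_distrib, Finset.sum_sub_distrib, ← Finset.mul_sum]
  ring

lemma isMinOn_ridgeObjective_iff {lam : ℝ} (hlam : 0 < lam) (D : Data n p)
    (b : EuclideanSpace ℝ (Fin p)) :
    IsMinOn (ridgeObjective lam D) Set.univ b ↔ gram D.1 b + lam • b = score D.1 D.2 := by
  constructor
  · intro hb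
    set g := score D.1 D.2 - (gram D.1 b + lam • b) with hg
    by_contra hne
    have hg0 : g ≠ 0 := fun h => hne (sub_eq_zero.mp h).symm
    have hpos : 0 < ‖g‖ ^ 2 := by positivity
    set q := inner ℝ (gram D.1 g) g + lam * ‖g‖ ^ 2 with hq
    have hqpos : 0 < q := add_pos_of_nonneg_of_pos (gram_nonneg _ _) (by positivity)
    -- `‖g‖²/q` is the optimal step along the descent direction `g`; it lowers the objective by
    -- `‖g‖⁴/q > 0`.
    have h1 := (isMinOn_iff.mp hb) (b + (‖g‖ ^ 2 / q) • g) (Set.mem_univ _)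
    rw [ridgeObjective_add, ← hg, map_smul, real_inner_smul_left, real_inner_smul_right,
      real_inner_smul_right, real_inner_self_eq_norm_sq, norm_smul, mul_pow, Real.norm_eq_abs,
      sq_abs] at h1
    have h2 : ‖g‖ ^ 2 / q * (‖g‖ ^ 2 / q * inner ℝ (gram D.1 g) g) +
        lam * ((‖g‖ ^ 2 / q) ^ 2 * ‖g‖ ^ 2) = (‖g‖ ^ 2) ^ 2 / q := by
      rw [show ‖g‖ ^ 2 / q * (‖g‖ ^ 2 / q * inner ℝ (gram D.1 g) g) +
        lam * ((‖g‖ ^ 2 / q) ^ 2 * ‖g‖ ^ 2) = (‖g‖ ^ 2 / q) ^ 2 * q by rw [hq]; ring]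
      field_simp
    have h3 : ‖g‖ ^ 2 / q * ‖g‖ ^ 2 = (‖g‖ ^ 2) ^ 2 / q := by ring
    have h4 : 0 < (‖g‖ ^ 2) ^ 2 / q := by positivity
    linarith
  · intro h
    rw [isMinOn_iff]
    intro c _
    have := ridgeObjective_add lam D b (c - b)
    rw [add_sub_cancel, h, sub_self, inner_zero_left] at this
    have h1 := gram_nonneg D.1 (c - b)
    have h2 : 0 ≤ lam * ‖c - b‖ ^ 2 := by positivity
    linarith

/-- The ridge estimator `(Xᵀ X + lam)⁻¹ Xᵀ y`. -/
noncomputable def ridgeEstimator (n p : ℕ) (lam : ℝ) : Estimator n p := fun D =>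
  WithLp.toLp 2 (((Matrix.of D.1)ᵀ * Matrix.of D.1 + lam • (1 : Matrix (Fin p) (Fin p) ℝ))⁻¹ *ᵥ
    ((Matrix.of D.1)ᵀ *ᵥ D.2))

lemma isRidgeEstimator_ridgeEstimator {lam : ℝ} (hlam : 0 < lam) :
    IsRidgeEstimator lam (ridgeEstimator n p lam) := by
  intro D
  rw [isMinOn_ridgeObjective_iff hlam]
  set M := (Matrix.of D.1)ᵀ * Matrix.of D.1 + lam • (1 : Matrix (Fin p) (Fin p) ℝ) with hM
  have hpd : M.PosDef := by
    refine Matrix.PosDef.posSemidef_add ?_ (Matrix.PosDef.one.smul hlam)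
    simpa using Matrix.posSemidef_conjTranspose_mul_self (Matrix.of D.1)
  have hu : IsUnit M.det := hpd.det_pos.ne'.isUnit
  have : gram D.1 (ridgeEstimator n p lam D) + lam • ridgeEstimator n p lam D =
      WithLp.toLp 2 (M *ᵥ (ridgeEstimator n p lam D).ofLp) := by
    rw [hM, Matrix.add_mulVec, Matrix.smul_mulVec, Matrix.one_mulVec, gram]
    simp [Matrix.toLpLin_apply]
  rw [this, ridgeEstimator, score]
  simp only [← hM]
  rw [Matrix.mulVec_mulVec, Matrix.mul_nonsing_inv _ hu, Matrix.one_mulVec]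

/-- Two solutions of the normal equations differ by an element of the kernel of `G + λ`, which is
trivial. A risk statement about every ridge estimator thus concerns a single measurable function. -/
lemma IsRidgeEstimator.eq_ridgeEstimator {lam : ℝ} (hlam : 0 < lam) {est : Estimator n p}
    (h : IsRidgeEstimator lam est) : est = ridgeEstimator n p lam := by
  funext D
  have h1 := (isMinOn_ridgeObjective_iff hlam D _).mp (h D)
  have h2 := (isMinOn_ridgeObjective_iff hlam D _).mp (isRidgeEstimator_ridgeEstimator hlam D)
  have h3 : gram D.1 (est D - ridgeEstimator n p lam D) +
      lam • (est D - ridgeEstimator n p lam D) = 0 := by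
    rw [map_sub, smul_sub, sub_add_sub_comm, h1, h2, sub_self]
  have h4 := norm_sq_le_of_add_smul_eq (gram_nonneg D.1) hlam h3
  rw [norm_zero] at h4
  have h5 : ‖est D - ridgeEstimator n p lam D‖ = 0 := by
    have : ‖est D - ridgeEstimator n p lam D‖ ^ 2 ≤ 0 := by simpa using h4
    exact pow_eq_zero_iff two_ne_zero |>.mp (le_antisymm this (sq_nonneg _))
  exact sub_eq_zero.mp (norm_eq_zero.mp h5)

lemma measurable_ridgeEstimator (lam : ℝ) : Measurable (ridgeEstimator n p lam) := by
  have hM : Continuous fun D : Data n p =>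
      (Matrix.of D.1)ᵀ * Matrix.of D.1 + lam • (1 : Matrix (Fin p) (Fin p) ℝ) := by
    have : Continuous fun D : Data n p => Matrix.of D.1 := continuous_fst
    fun_prop
  refine (WithLp.measurable_toLp 2 _).comp (measurable_pi_lambda _ fun j => ?_)
  simp only [Matrix.mulVec, dotProduct, Matrix.inv_def, Ring.inverse_eq_inv', Matrix.smul_apply,
    smul_eq_mul]
  refine Finset.measurable_sum _ fun i _ => Measurable.mul (Measurable.mul ?_ ?_) ?_
  · exact hM.matrix_det.measurable.inv
  · exact (hM.matrix_adjugate.matrix_elem j i).measurable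
  · exact Finset.measurable_sum _ fun l _ => by
      simp only [Matrix.transpose_apply, Matrix.of_apply]
      fun_prop

lemma ridgeEstimator_response {lam : ℝ} (hlam : 0 < lam) (σ : ℝ) (β : EuclideanSpace ℝ (Fin p))
    (X : Fin n → Fin p → ℝ) (z : Fin n → ℝ) :
    gram X (ridgeEstimator n p lam (X, response σ β X z) - β) +
      lam • (ridgeEstimator n p lam (X, response σ β X z) - β) =
        σ • score X z - lam • β := by
  have h := (isMinOn_ridgeObjective_iff hlam _ _).mp
    (isRidgeEstimator_ridgeEstimator hlam (X, response σ β X z))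
  have hr : response σ β X z = (fun i => X i ⬝ᵥ β.ofLp) + σ • z := rfl
  simp only at h
  rw [map_sub, smul_sub, sub_add_sub_comm, h, hr, score_add, score_smul, ← gram_apply]
  abel

/-- The risk of the ridge estimator conditionally on the design, averaged over `±z`. -/
lemma norm_sq_ridgeEstimator_sub_add_le {lam : ℝ} (hlam : 0 < lam) (σ : ℝ)
    (β : EuclideanSpace ℝ (Fin p)) (X : Fin n → Fin p → ℝ) (z : Fin n → ℝ) :
    ‖ridgeEstimator n p lam (X, response σ β X z) - β‖ ^ 2 +
      ‖ridgeEstimator n p lam (X, response σ β X (-z)) - β‖ ^ 2 ≤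
      2 * (‖β‖ ^ 2 - 2 / lam * inner ℝ (gram X β) β + 3 / lam ^ 2 * ‖gram X β‖ ^ 2 +
        σ ^ 2 / lam ^ 2 * ‖score X z‖ ^ 2) := by
  refine (norm_sq_add_norm_sq_le (gram_symm X) (gram_nonneg X) hlam
    (ridgeEstimator_response hlam σ β X z) ?_).trans_eq ?_
  · rw [ridgeEstimator_response hlam σ β X (-z)]
    congr 1
    rw [show -z = (-1 : ℝ) • z by simp, score_smul]; simp
  · rw [norm_smul, mul_pow, Real.norm_eq_abs, sq_abs]; ring

end Ridge

/-! ### Design and noise averages, and the risk bound for ridge. -/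

section RidgeRisk

variable {n p : ℕ}

instance isProbabilityMeasure_designLaw : IsProbabilityMeasure (designLaw n p) := by
  unfold designLaw; infer_instance

instance isProbabilityMeasure_noiseLaw : IsProbabilityMeasure (noiseLaw n) := by
  unfold noiseLaw; infer_instance

/-- The law of a row of the design. -/
noncomputable abbrev rowLaw (n p : ℕ) : Measure (Fin p → ℝ) :=
  Measure.pi fun _ => gaussianReal 0 ((n : ℝ≥0)⁻¹)

lemma integrable_row {f : (Fin p → ℝ) → ℝ} (hf : Integrable f (rowLaw n p)) (i : Fin n) :
    Integrable (fun X : Fin n → Fin p → ℝ => f (X i)) (designLaw n p) :=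
  integrable_comp_eval (μ := fun _ : Fin n => rowLaw n p) hf

lemma integral_row {f : (Fin p → ℝ) → ℝ} (hf : Integrable f (rowLaw n p)) (i : Fin n) :
    ∫ X : Fin n → Fin p → ℝ, f (X i) ∂designLaw n p = ∫ x, f x ∂rowLaw n p :=
  integral_comp_eval (μ := fun _ : Fin n => rowLaw n p) hf.aestronglyMeasurable

lemma norm_sq_eq_dotProduct (β : EuclideanSpace ℝ (Fin p)) :
    ‖β‖ ^ 2 = β.ofLp ⬝ᵥ β.ofLp := by
  rw [EuclideanSpace.real_norm_sq_eq]
  simp only [dotProduct, pow_two]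

lemma integral_inner_gram (hn : n ≠ 0) (β : EuclideanSpace ℝ (Fin p)) :
    Integrable (fun X => inner ℝ (gram X β) β) (designLaw n p) ∧
    ∫ X, inner ℝ (gram X β) β ∂designLaw n p = ‖β‖ ^ 2 := by
  have hi : Integrable (fun x : Fin p → ℝ => (x ⬝ᵥ β.ofLp) ^ 2) (rowLaw n p) :=
    (memLp_dotProduct_pi_gaussianReal _ _ 2).integrable_sq
  simp only [inner_gram, ← pow_two]
  refine ⟨integrable_finsetSum _ fun i _ => integrable_row hi i, ?_⟩
  rw [integral_finsetSum _ fun i _ => integrable_row hi i]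
  simp only [integral_row hi, rowLaw, integral_dotProduct_sq_pi_gaussianReal,
    Finset.sum_const, Finset.card_univ, Fintype.card_fin, nsmul_eq_mul, norm_sq_eq_dotProduct]
  have : (n : ℝ) ≠ 0 := by exact_mod_cast hn
  push_cast
  field_simp

/-- The fourth moment of a standard Gaussian. -/
noncomputable def gaussianFourthMoment : ℝ := ∫ x, x ^ 4 ∂(gaussianReal 0 1)

lemma gaussianFourthMoment_nonneg : 0 ≤ gaussianFourthMoment :=
  integral_nonneg fun x => by positivity

lemma memLp_coord_mul_dotProduct (w : Fin p → ℝ) (j : Fin p) :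
    MemLp (fun x : Fin p → ℝ => x j * (x ⬝ᵥ w)) 2 (rowLaw n p) := by
  have h1 : MemLp (fun x : Fin p → ℝ => x j) 4 (rowLaw n p) := by
    simpa using memLp_dotProduct_pi_gaussianReal (n : ℝ≥0)⁻¹ (Pi.single j 1) 4
  have h2 : MemLp (fun x : Fin p → ℝ => x ⬝ᵥ w) 4 (rowLaw n p) :=
    memLp_dotProduct_pi_gaussianReal _ w 4
  have : ENNReal.HolderTriple 4 4 2 := ⟨by
    rw [← two_mul, show (4 : ℝ≥0∞) = 2 * 2 by norm_num,
      ENNReal.mul_inv (by simp) (by simp), ← mul_assoc,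
      ENNReal.mul_inv_cancel (by simp) (by simp), one_mul]⟩
  exact h2.mul h1

lemma integral_coord_mul_dotProduct (w : Fin p → ℝ) (j : Fin p) :
    ∫ x, x j * (x ⬝ᵥ w) ∂rowLaw n p = (n : ℝ)⁻¹ * w j := by
  have := integral_dotProduct_mul_dotProduct_pi_gaussianReal (n : ℝ≥0)⁻¹ (Pi.single j 1) w
  simpa using this

lemma integral_coord_mul_dotProduct_sq_le (w : Fin p → ℝ) (j : Fin p) :
    ∫ x, (x j * (x ⬝ᵥ w)) ^ 2 ∂rowLaw n p ≤
      gaussianFourthMoment * ((n : ℝ)⁻¹ ^ 2 * (w ⬝ᵥ w)) := by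
  set s := w ⬝ᵥ w with hs
  have hs0 : 0 ≤ s := dotProduct_self_nonneg' w
  rcases hs0.eq_or_lt with h0 | hpos
  · have : w = 0 := dotProduct_self_eq_zero.mp (hs ▸ h0.symm)
    simp [← h0, this]
  have hi : ∀ u : Fin p → ℝ, Integrable (fun x : Fin p → ℝ => (x ⬝ᵥ u) ^ 4) (rowLaw n p) := by
    intro u
    have h := (memLp_dotProduct_pi_gaussianReal (n : ℝ≥0)⁻¹ u 4).integrable_norm_pow'
    simpa [Real.norm_eq_abs, Even.pow_abs (show Even 4 by decide)] using h
  have hj : Integrable (fun x : Fin p → ℝ => (x j) ^ 4) (rowLaw n p) := by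
    simpa using hi (Pi.single j 1)
  have hj4 : ∫ x, (x j) ^ 4 ∂rowLaw n p = (n : ℝ)⁻¹ ^ 2 * gaussianFourthMoment := by
    have := integral_dotProduct_pow_four_pi_gaussianReal (n : ℝ≥0)⁻¹ (Pi.single j 1)
    simpa [gaussianFourthMoment] using this
  have hw4 : ∫ x, (x ⬝ᵥ w) ^ 4 ∂rowLaw n p = (n : ℝ)⁻¹ ^ 2 * s ^ 2 * gaussianFourthMoment := by
    have := integral_dotProduct_pow_four_pi_gaussianReal (n : ℝ≥0)⁻¹ w
    simpa [gaussianFourthMoment, hs] using this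
  -- AM–GM, weighted by `s` so that both fourth-moment terms have the same mean.
  have hle : ∫ x, (x j * (x ⬝ᵥ w)) ^ 2 ∂rowLaw n p ≤
      ∫ x, (s / 2 * x j ^ 4 + (2 * s)⁻¹ * (x ⬝ᵥ w) ^ 4) ∂rowLaw n p := by
    refine integral_mono (memLp_coord_mul_dotProduct w j).integrable_sq
      ((hj.const_mul _).add ((hi w).const_mul _)) fun x => ?_
    have : s / 2 * x j ^ 4 + (2 * s)⁻¹ * (x ⬝ᵥ w) ^ 4 - (x j * (x ⬝ᵥ w)) ^ 2 =
        (2 * s)⁻¹ * (s * x j ^ 2 - (x ⬝ᵥ w) ^ 2) ^ 2 := by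
      field_simp; ring
    have h2 : 0 ≤ (2 * s)⁻¹ * (s * x j ^ 2 - (x ⬝ᵥ w) ^ 2) ^ 2 := by positivity
    simp only
    linarith
  refine hle.trans_eq ?_
  rw [integral_add (hj.const_mul _) ((hi w).const_mul _), integral_const_mul, integral_const_mul,
    hj4, hw4]
  field_simp; ring

/-- Coordinate `j` of `XᵀXβ` is a sum of `n` i.i.d. terms of mean `βⱼ/n`, so its second moment is
`βⱼ²` plus a variance at most `K‖β‖²/n`. Summing the variances over `p` coordinates gives the factor
`p/n`. -/
lemma integral_norm_gram_sq_le (hn : n ≠ 0) (β : EuclideanSpace ℝ (Fin p)) :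
    Integrable (fun X => ‖gram X β‖ ^ 2) (designLaw n p) ∧
    ∫ X, ‖gram X β‖ ^ 2 ∂designLaw n p ≤ (1 + gaussianFourthMoment * (p / n)) * ‖β‖ ^ 2 := by
  have hn' : (n : ℝ) ≠ 0 := by exact_mod_cast hn
  have hnorm : ∀ X : Fin n → Fin p → ℝ, ‖gram X β‖ ^ 2 =
      ∑ j, (∑ i, X i j * (X i ⬝ᵥ β.ofLp)) ^ 2 := by
    intro X
    rw [EuclideanSpace.real_norm_sq_eq, gram_apply]
    simp only [score_apply]
  have hmem : ∀ j, MemLp (fun X : Fin n → Fin p → ℝ => ∑ i, X i j * (X i ⬝ᵥ β.ofLp)) 2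
      (designLaw n p) := fun j => memLp_finsetSum _ fun i _ =>
    (memLp_coord_mul_dotProduct β.ofLp j).comp_measurePreserving
      (measurePreserving_eval (fun _ : Fin n => rowLaw n p) i)
  simp only [hnorm]
  refine ⟨integrable_finsetSum _ fun j _ => (hmem j).integrable_sq, ?_⟩
  rw [integral_finsetSum _ fun j _ => (hmem j).integrable_sq]
  have hj : ∀ j, ∫ X, (∑ i, X i j * (X i ⬝ᵥ β.ofLp)) ^ 2 ∂designLaw n p ≤
      gaussianFourthMoment * ((n : ℝ)⁻¹ * ‖β‖ ^ 2) + β.ofLp j ^ 2 := by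
    intro j
    have hW := memLp_coord_mul_dotProduct (n := n) β.ofLp j
    have h1 := variance_eq_sub (hmem j)
    have h2 := variance_sum_pi (ι := Fin n) (fun _ => hW)
    have h3 : (∑ i, fun ω : Fin n → Fin p → ℝ => ω i j * (ω i ⬝ᵥ β.ofLp)) =
        fun X : Fin n → Fin p → ℝ => ∑ i, X i j * (X i ⬝ᵥ β.ofLp) := by
      ext X; simp
    rw [h3] at h2
    have h4 : Var[fun x : Fin p → ℝ => x j * (x ⬝ᵥ β.ofLp); rowLaw n p] ≤
        gaussianFourthMoment * ((n : ℝ)⁻¹ ^ 2 * ‖β‖ ^ 2) := by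
      rw [norm_sq_eq_dotProduct]
      exact (variance_le_expectation_sq hW.aestronglyMeasurable).trans
        (integral_coord_mul_dotProduct_sq_le β.ofLp j)
    have h5 : ∫ X : Fin n → Fin p → ℝ, ∑ i, X i j * (X i ⬝ᵥ β.ofLp) ∂designLaw n p =
        β.ofLp j := by
      rw [integral_finsetSum _ fun i _ => integrable_row (hW.integrable one_le_two) i]
      simp only [integral_row (hW.integrable one_le_two), integral_coord_mul_dotProduct,
        Finset.sum_const, Finset.card_univ, Fintype.card_fin, nsmul_eq_mul]
      field_simp
    rw [h5] at h1
    simp only [Pi.pow_apply, Finset.sum_const, Finset.card_univ, Fintype.card_fin,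
      nsmul_eq_mul] at h1 h2
    have h6 : Var[fun X : Fin n → Fin p → ℝ => ∑ i, X i j * (X i ⬝ᵥ β.ofLp); designLaw n p] =
      n * Var[fun x : Fin p → ℝ => x j * (x ⬝ᵥ β.ofLp); rowLaw n p] := h2
    have h7 : (n : ℝ) * Var[fun x : Fin p → ℝ => x j * (x ⬝ᵥ β.ofLp); rowLaw n p] ≤
        n * (gaussianFourthMoment * ((n : ℝ)⁻¹ ^ 2 * ‖β‖ ^ 2)) := by gcongr
    have h8 : n * (gaussianFourthMoment * ((n : ℝ)⁻¹ ^ 2 * ‖β‖ ^ 2)) =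
        gaussianFourthMoment * ((n : ℝ)⁻¹ * ‖β‖ ^ 2) := by field_simp
    linarith
  refine (Finset.sum_le_sum fun j _ => hj j).trans_eq ?_
  rw [Finset.sum_add_distrib, ← EuclideanSpace.real_norm_sq_eq]
  simp only [Finset.sum_const, Finset.card_univ, Fintype.card_fin, nsmul_eq_mul]
  ring

lemma integral_norm_score_sq (X : Fin n → Fin p → ℝ) :
    Integrable (fun z => ‖score X z‖ ^ 2) (noiseLaw n) ∧
    ∫ z, ‖score X z‖ ^ 2 ∂noiseLaw n = ∑ i, X i ⬝ᵥ X i := by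
  have h : ∀ z, ‖score X z‖ ^ 2 = ∑ j, (z ⬝ᵥ fun i => X i j) ^ 2 := by
    intro z
    rw [EuclideanSpace.real_norm_sq_eq]
    simp only [score_apply, dotProduct, mul_comm]
  have hi : ∀ j, Integrable (fun z => (z ⬝ᵥ fun i => X i j) ^ 2) (noiseLaw n) := fun j =>
    (memLp_dotProduct_pi_gaussianReal 1 _ 2).integrable_sq
  simp only [h]
  refine ⟨integrable_finsetSum _ fun j _ => hi j, ?_⟩
  rw [integral_finsetSum _ fun j _ => hi j]
  simp only [noiseLaw, integral_dotProduct_sq_pi_gaussianReal, NNReal.coe_one, one_mul]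
  simp only [dotProduct]
  exact Finset.sum_comm

lemma integral_sum_dotProduct_self (hn : n ≠ 0) :
    Integrable (fun X => ∑ i, X i ⬝ᵥ X i) (designLaw n p) ∧
    ∫ X, ∑ i, X i ⬝ᵥ X i ∂designLaw n p = p := by
  have hn' : (n : ℝ) ≠ 0 := by exact_mod_cast hn
  have h1 : ∀ j, Integrable (fun x : Fin p → ℝ => x j * x j) (rowLaw n p) := by
    intro j
    have := (memLp_dotProduct_pi_gaussianReal (n : ℝ≥0)⁻¹ (Pi.single j 1) 2).integrable_sq
    simpa [pow_two] using this
  have h2 : ∀ j, ∫ x, x j * x j ∂rowLaw n p = (n : ℝ)⁻¹ := by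
    intro j
    have := integral_dotProduct_sq_pi_gaussianReal (n : ℝ≥0)⁻¹ (Pi.single j 1)
    simpa [pow_two] using this
  have hi : Integrable (fun x : Fin p → ℝ => x ⬝ᵥ x) (rowLaw n p) :=
    integrable_finsetSum _ fun j _ => h1 j
  refine ⟨integrable_finsetSum _ fun i _ => integrable_row hi i, ?_⟩
  rw [integral_finsetSum _ fun i _ => integrable_row hi i]
  simp only [integral_row hi]
  simp only [dotProduct]
  rw [integral_finsetSum _ fun j _ => h1 j]
  simp only [h2, Finset.sum_const, Finset.card_univ, Fintype.card_fin, nsmul_eq_mul]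
  field_simp

lemma measurable_response (σ : ℝ) (β : EuclideanSpace ℝ (Fin p)) :
    Measurable fun ω : (Fin n → Fin p → ℝ) × (Fin n → ℝ) => response σ β ω.1 ω.2 := by
  unfold response
  fun_prop

lemma risk_eq_lintegral_lintegral (σ : ℝ) {est : Estimator n p} (hest : Measurable est)
    (β : EuclideanSpace ℝ (Fin p)) :
    risk σ est β = ∫⁻ X, ∫⁻ z, ENNReal.ofReal (‖est (X, response σ β X z) - β‖ ^ 2)
      ∂noiseLaw n ∂designLaw n p := by
  rw [risk, lintegral_prod]
  · simp only [ENNReal.ofReal_pow (norm_nonneg _), ofReal_norm]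
  · have := measurable_response (n := n) σ β
    exact (((hest.comp (measurable_fst.prodMk this)).sub_const β).enorm.pow_const 2).aemeasurable

lemma risk_ridgeEstimator_le (hn : n ≠ 0) {lam : ℝ} (hlam : 0 < lam) (σ : ℝ)
    (β : EuclideanSpace ℝ (Fin p)) :
    risk σ (ridgeEstimator n p lam) β ≤ ENNReal.ofReal
      ((1 - 2 / lam + 3 / lam ^ 2 * (1 + gaussianFourthMoment * (p / n))) * ‖β‖ ^ 2 +
        σ ^ 2 / lam ^ 2 * p) := by
  set A : (Fin n → Fin p → ℝ) → ℝ := fun X =>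
    ‖β‖ ^ 2 - 2 / lam * inner ℝ (gram X β) β + 3 / lam ^ 2 * ‖gram X β‖ ^ 2 with hA
  set c := σ ^ 2 / lam ^ 2 with hc
  have hmr : Measurable (ridgeEstimator n p lam) := measurable_ridgeEstimator lam
  have hnn : ∀ X z, 0 ≤ A X + c * ‖score X z‖ ^ 2 := fun X z => by
    have h := norm_sq_ridgeEstimator_sub_add_le hlam σ β X z
    have h' : 0 ≤ 2 * (A X + c * ‖score X z‖ ^ 2) := le_trans (by positivity) h
    linarith
  have hX : ∀ X, ∫⁻ z, ENNReal.ofReal (‖ridgeEstimator n p lam (X, response σ β X z) - β‖ ^ 2)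
      ∂noiseLaw n ≤ ENNReal.ofReal (A X + c * ∑ i, X i ⬝ᵥ X i) := by
    intro X
    set H : (Fin n → ℝ) → ℝ≥0∞ := fun z =>
      ENNReal.ofReal (‖ridgeEstimator n p lam (X, response σ β X z) - β‖ ^ 2) with hH
    have hHm : Measurable H := by
      have : Measurable fun z : Fin n → ℝ => (X, response σ β X z) := by
        unfold response; fun_prop
      exact (((hmr.comp this).sub_const β).norm.pow_const 2).ennreal_ofReal
    have hneg : ∫⁻ z, H (-z) ∂noiseLaw n = ∫⁻ z, H z ∂noiseLaw n :=
      (measurePreserving_neg_pi_gaussianReal 1).lintegral_comp hHm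
    -- The noise law is symmetric, so the integral may be doubled by adding its reflection, to which
    -- the `±z` bound applies.
    have h2 : 2 * ∫⁻ z, H z ∂noiseLaw n ≤ 2 * ENNReal.ofReal (A X + c * ∑ i, X i ⬝ᵥ X i) := by
      obtain ⟨hi, hI⟩ := integral_norm_score_sq X
      have hAi : Integrable (fun z => A X + c * ‖score X z‖ ^ 2) (noiseLaw n) :=
        (integrable_const _).add (hi.const_mul c)
      calc 2 * ∫⁻ z, H z ∂noiseLaw n = ∫⁻ z, H z + H (-z) ∂noiseLaw n := by
            rw [lintegral_add_left hHm, hneg, two_mul]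
        _ ≤ ∫⁻ z, 2 * ENNReal.ofReal (A X + c * ‖score X z‖ ^ 2) ∂noiseLaw n := by
            refine lintegral_mono fun z => ?_
            simp only [hH]
            have h2 : (2 : ℝ≥0∞) * ENNReal.ofReal (A X + c * ‖score X z‖ ^ 2) =
                ENNReal.ofReal (2 * (A X + c * ‖score X z‖ ^ 2)) := by
              rw [ENNReal.ofReal_mul (by norm_num), ENNReal.ofReal_ofNat]
            rw [← ENNReal.ofReal_add (by positivity) (by positivity), h2]
            exact ENNReal.ofReal_le_ofReal (norm_sq_ridgeEstimator_sub_add_le hlam σ β X z)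
        _ = 2 * ENNReal.ofReal (A X + c * ∑ i, X i ⬝ᵥ X i) := by
            rw [lintegral_const_mul' _ _ (by simp), ← ofReal_integral_eq_lintegral_ofReal hAi
              (ae_of_all _ (hnn X)),
              integral_add (integrable_const _) (hi.const_mul c), integral_const_mul, hI]
            simp
    exact (ENNReal.mul_le_mul_iff_right (by simp) (by simp)).mp h2
  rw [risk_eq_lintegral_lintegral σ hmr β]
  refine (lintegral_mono hX).trans ?_
  obtain ⟨i1, e1⟩ := integral_inner_gram hn β
  obtain ⟨i2, e2⟩ := integral_norm_gram_sq_le hn β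
  obtain ⟨i3, e3⟩ := integral_sum_dotProduct_self (p := p) hn
  have iA : Integrable A (designLaw n p) :=
    ((integrable_const _).sub (i1.const_mul _)).add (i2.const_mul _)
  have iAS : Integrable (fun X => A X + c * ∑ i, X i ⬝ᵥ X i) (designLaw n p) :=
    iA.add (i3.const_mul c)
  rw [← ofReal_integral_eq_lintegral_ofReal iAS]
  · apply ENNReal.ofReal_le_ofReal
    rw [integral_add iA (i3.const_mul c), integral_const_mul, e3]
    have : ∫ X, A X ∂designLaw n p = ‖β‖ ^ 2 - 2 / lam * ‖β‖ ^ 2 +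
        3 / lam ^ 2 * ∫ X, ‖gram X β‖ ^ 2 ∂designLaw n p := by
      have i0 : Integrable (fun X => ‖β‖ ^ 2 - 2 / lam * inner ℝ (gram X β) β) (designLaw n p) :=
        (integrable_const _).sub (i1.const_mul _)
      simp only [hA]
      rw [integral_add i0 (i2.const_mul _), integral_sub (integrable_const _) (i1.const_mul _),
        integral_const_mul, integral_const_mul, e1]
      simp
    rw [this]
    have h3 := mul_le_mul_of_nonneg_left e2 (show 0 ≤ 3 / lam ^ 2 by positivity)
    linarith
  · refine ae_of_all _ fun X => ?_
    have : 0 ≤ ∫ z, (A X + c * ‖score X z‖ ^ 2) ∂noiseLaw n := integral_nonneg fun z => hnn X z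
    obtain ⟨hi, hI⟩ := integral_norm_score_sq X
    rw [integral_add (integrable_const _) (hi.const_mul c), integral_const_mul, hI] at this
    simpa using this

end RidgeRisk

/-! ### Bayes risk of one block for a fixed design. -/

section Block

/-- The right side integrates the positive part, and the Bochner integral of a non-integrable
function is 0, so no hypothesis on `f` is needed. -/
lemma ofReal_integral_le_lintegral_ofReal {α : Type*} [MeasurableSpace α] {μ : Measure α}
    (f : α → ℝ) : ENNReal.ofReal (∫ a, f a ∂μ) ≤ ∫⁻ a, ENNReal.ofReal (f a) ∂μ := by
  by_cases hf : Integrable f μ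
  · rw [integral_eq_lintegral_pos_part_sub_lintegral_neg_part hf]
    refine (ENNReal.ofReal_le_ofReal (sub_le_self _ ENNReal.toReal_nonneg)).trans ?_
    exact ENNReal.ofReal_toReal_le
  · simp [integral_undef hf]

/-- The sign encoded by a Boolean. -/
def signOf (b : Bool) : ℝ := if b then 1 else -1

lemma signOf_mul_self (b : Bool) : signOf b * signOf b = 1 := by
  cases b <;> simp [signOf]

variable {J : Type*} [Fintype J] {ι : Type*} [Fintype ι]

/-- Chebyshev's sum inequality: both sequences increase with `u`. It decouples the two sums so that
the design average involves one column at a time. -/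
lemma sum_sinh_mul_sum_exp_le (u : J → ℝ) :
    (∑ j, Real.sinh (u j)) * ∑ j, Real.exp (u j / 2) ≤
      Fintype.card J * ∑ j, Real.sinh (u j) * Real.exp (u j / 2) := by
  refine Monovary.sum_mul_sum_le_card_mul_sum fun i j hij => ?_
  have : u i < u j := by
    have := Real.exp_lt_exp.mp hij
    linarith
  exact (Real.sinh_lt_sinh.mpr this).le

lemma sq_card_le_sum_exp_neg_mul_sum_exp (u : J → ℝ) :
    (Fintype.card J : ℝ) ^ 2 ≤ (∑ j, Real.exp (-(u j / 2))) * ∑ j, Real.exp (u j / 2) := by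
  have h := Finset.sum_mul_sq_le_sq_mul_sq Finset.univ
    (fun j => Real.exp (-(u j / 4))) (fun j => Real.exp (u j / 4))
  have h1 : ∀ j, Real.exp (-(u j / 4)) * Real.exp (u j / 4) = 1 := fun j => by
    rw [← Real.exp_add]; simp
  have h2 : ∀ j, Real.exp (-(u j / 4)) ^ 2 = Real.exp (-(u j / 2)) := fun j => by
    rw [← Real.exp_nat_mul]; congr 1; push_cast; ring
  have h3 : ∀ j, Real.exp (u j / 4) ^ 2 = Real.exp (u j / 2) := fun j => by
    rw [← Real.exp_nat_mul]; congr 1; push_cast; ring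
  simpa only [h1, h2, h3, Finset.sum_const, Finset.card_univ, nsmul_eq_mul, mul_one] using h

lemma integral_likelihoodRatio (w : ι → ℝ) :
    Integrable (fun z => Real.exp (z ⬝ᵥ w - w ⬝ᵥ w / 2))
      (Measure.pi fun _ : ι => gaussianReal 0 1) ∧
    ∫ z, Real.exp (z ⬝ᵥ w - w ⬝ᵥ w / 2) ∂(Measure.pi fun _ : ι => gaussianReal 0 1) = 1 := by
  simp only [sub_eq_add_neg, Real.exp_add]
  refine ⟨(integrable_exp_dotProduct_pi_gaussianReal w).mul_const _, ?_⟩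
  rw [integral_mul_const, integral_exp_dotProduct_pi_gaussianReal, ← Real.exp_add]
  simp

/-- Each squared likelihood ratio has mean `exp u`, and the product of the two is the constant `exp
(-u)`. -/
lemma integral_likelihoodRatio_sub_sq (w : ι → ℝ) :
    Integrable (fun z => (Real.exp (z ⬝ᵥ w - w ⬝ᵥ w / 2) - Real.exp (z ⬝ᵥ (-w) - w ⬝ᵥ w / 2)) ^ 2)
      (Measure.pi fun _ : ι => gaussianReal 0 1) ∧
    ∫ z, (Real.exp (z ⬝ᵥ w - w ⬝ᵥ w / 2) - Real.exp (z ⬝ᵥ (-w) - w ⬝ᵥ w / 2)) ^ 2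
      ∂(Measure.pi fun _ : ι => gaussianReal 0 1) = 4 * Real.sinh (w ⬝ᵥ w) := by
  set u := w ⬝ᵥ w with hu
  have h : ∀ z : ι → ℝ, (Real.exp (z ⬝ᵥ w - u / 2) - Real.exp (z ⬝ᵥ (-w) - u / 2)) ^ 2 =
      (Real.exp (z ⬝ᵥ ((2 : ℝ) • w)) + Real.exp (z ⬝ᵥ ((-2 : ℝ) • w)) - 2) * Real.exp (-u) := by
    intro z
    simp only [dotProduct_smul, dotProduct_neg, smul_eq_mul]
    set a := z ⬝ᵥ w
    have e1 : Real.exp (2 * a) * Real.exp (-u) = Real.exp (a - u / 2) ^ 2 := by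
      rw [← Real.exp_add, ← Real.exp_nat_mul]; congr 1; push_cast; ring
    have e2 : Real.exp (-2 * a) * Real.exp (-u) = Real.exp (-a - u / 2) ^ 2 := by
      rw [← Real.exp_add, ← Real.exp_nat_mul]; congr 1; push_cast; ring
    have e3 : Real.exp (-u) = Real.exp (a - u / 2) * Real.exp (-a - u / 2) := by
      rw [← Real.exp_add]; congr 1; ring
    rw [sub_mul, add_mul, e1, e2, e3]
    ring
  have i1 := integrable_exp_dotProduct_pi_gaussianReal ((2 : ℝ) • w)
  have i2 := integrable_exp_dotProduct_pi_gaussianReal ((-2 : ℝ) • w)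
  have i3 : Integrable (fun z => Real.exp (z ⬝ᵥ ((2 : ℝ) • w)) + Real.exp (z ⬝ᵥ ((-2 : ℝ) • w)))
      (Measure.pi fun _ : ι => gaussianReal 0 1) := i1.add i2
  simp only [h]
  refine ⟨(i3.sub (integrable_const 2)).mul_const _, ?_⟩
  rw [integral_mul_const, integral_sub i3 (integrable_const _), integral_add i1 i2,
    integral_exp_dotProduct_pi_gaussianReal, integral_exp_dotProduct_pi_gaussianReal]
  simp only [dotProduct_smul, smul_dotProduct, smul_eq_mul, ← hu, integral_const, probReal_univ,
    one_mul]
  rw [Real.sinh_eq, show (2 * (2 * u)) / 2 = u + u by ring,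
    show (-2 * (-2 * u)) / 2 = u + u by ring, Real.exp_add, Real.exp_neg]
  field_simp
  ring

variable [DecidableEq J]

lemma sum_sub_ite_sq (e : J → ℝ) (j : J) (c : ℝ) :
    ∑ i, (e i - if j = i then c else 0) ^ 2 = ∑ i, e i ^ 2 - 2 * (c * e j) + c ^ 2 := by
  have : ∀ i, (e i - if j = i then c else 0) ^ 2 =
      e i ^ 2 - (if j = i then 2 * (c * e i) - c ^ 2 else 0) := by
    intro i; split_ifs <;> ring
  simp only [this, Finset.sum_sub_distrib, Finset.sum_ite_eq, Finset.mem_univ, if_true]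
  ring

/-- The posterior-weighted loss is quadratic in `e`, with minimum `τ²F - τ²∑(P - M)²/F` for `F = ∑(P
+ M)`. Replacing `1/F` by the larger `B` leaves a bound whose expectation is explicit. -/
lemma le_sum_weighted_sq (P M e : J → ℝ) {τ B : ℝ} (hF : 0 < ∑ j, (P j + M j))
    (hB : 1 ≤ B * ∑ j, (P j + M j)) :
    τ ^ 2 * ∑ j, (P j + M j) - B * τ ^ 2 * ∑ j, (P j - M j) ^ 2 ≤
      ∑ j, (P j * ∑ i, (e i - if j = i then τ else 0) ^ 2 +
        M j * ∑ i, (e i - if j = i then -τ else 0) ^ 2) := by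
  set F := ∑ j, (P j + M j) with hFdef
  have hrhs : ∑ j, (P j * ∑ i, (e i - if j = i then τ else 0) ^ 2 +
        M j * ∑ i, (e i - if j = i then -τ else 0) ^ 2) =
      F * ∑ j, e j ^ 2 - 2 * τ * ∑ j, (P j - M j) * e j + τ ^ 2 * F := by
    simp only [sum_sub_ite_sq]
    have : ∀ j, P j * (∑ i, e i ^ 2 - 2 * (τ * e j) + τ ^ 2) +
        M j * (∑ i, e i ^ 2 - 2 * (-τ * e j) + (-τ) ^ 2) =
        (P j + M j) * (∑ i, e i ^ 2) - 2 * τ * ((P j - M j) * e j) + τ ^ 2 * (P j + M j) :=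
      fun j => by ring
    simp only [this, Finset.sum_add_distrib, Finset.sum_sub_distrib, ← Finset.mul_sum,
      ← Finset.sum_mul, hFdef]
  have hj : ∀ j, 0 ≤ F * e j ^ 2 - 2 * τ * ((P j - M j) * e j) +
      B * τ ^ 2 * (P j - M j) ^ 2 := by
    intro j
    refine nonneg_of_mul_nonneg_right (a := F) ?_ hF
    have : F * (F * e j ^ 2 - 2 * τ * ((P j - M j) * e j) + B * τ ^ 2 * (P j - M j) ^ 2) =
        (F * e j - τ * (P j - M j)) ^ 2 + (B * F - 1) * (τ * (P j - M j)) ^ 2 := by ring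
    rw [this]
    exact add_nonneg (sq_nonneg _) (mul_nonneg (by linarith) (sq_nonneg _))
  have hsum := Finset.sum_nonneg fun j (_ : j ∈ Finset.univ) => hj j
  simp only [Finset.sum_add_distrib, Finset.sum_sub_distrib, ← Finset.mul_sum] at hsum
  rw [hrhs]
  linarith

/-- Bayes risk lower bound for one block: a signal `±τ` at a uniformly chosen position of the
block, shifting the noise by `±w j`. -/
lemma block_bayesRisk_ge [Nonempty J] (w : J → ι → ℝ) (τ : ℝ) {e : (ι → ℝ) → J → ℝ}
    (he : Measurable e) :
    ENNReal.ofReal (2 * Fintype.card J * τ ^ 2 - 2 * τ ^ 2 / Fintype.card J *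
        ∑ j, Real.sinh (w j ⬝ᵥ w j) * Real.exp (w j ⬝ᵥ w j / 2)) ≤
      ∑ v : J × Bool, ∫⁻ z, ENNReal.ofReal
        (∑ i, (e (z + signOf v.2 • w v.1) i - if v.1 = i then signOf v.2 * τ else 0) ^ 2)
        ∂(Measure.pi fun _ : ι => gaussianReal 0 1) := by
  set μ : Measure (ι → ℝ) := Measure.pi fun _ : ι => gaussianReal 0 1 with hμ
  set m : ℝ := (Fintype.card J : ℝ) with hm
  have hmpos : 0 < m := by rw [hm]; exact_mod_cast Fintype.card_pos
  set u : J → ℝ := fun j => w j ⬝ᵥ w j with hu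
  let P : J → (ι → ℝ) → ℝ := fun j z => Real.exp (z ⬝ᵥ w j - u j / 2)
  let M : J → (ι → ℝ) → ℝ := fun j z => Real.exp (z ⬝ᵥ (-w j) - u j / 2)
  have hPm : ∀ j, Measurable (P j) := fun j => by fun_prop
  have hMm : ∀ j, Measurable (M j) := fun j => by fun_prop
  -- A bound for `1/F` free of `z`: `cosh ≥ 1` gives `F ≥ 2∑exp(-u/2)`, and Cauchy–Schwarz then
  -- gives `BF ≥ 1`.
  set B : ℝ := (∑ j, Real.exp (u j / 2)) / (2 * m ^ 2) with hB
  set h : (ι → ℝ) → ℝ := fun z =>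
    τ ^ 2 * ∑ j, (P j z + M j z) - B * τ ^ 2 * ∑ j, (P j z - M j z) ^ 2 with hh
  -- Cameron–Martin moves every hypothesis onto the same noise, so that one value `e z` faces all of
  -- them.
  have hshift : ∀ (s : ℝ) (j : J), s * s = 1 →
      ∫⁻ z, ENNReal.ofReal (∑ i, (e (z + s • w j) i - if j = i then s * τ else 0) ^ 2) ∂μ =
      ∫⁻ z, ENNReal.ofReal (Real.exp (z ⬝ᵥ (s • w j) - u j / 2) *
        ∑ i, (e z i - if j = i then s * τ else 0) ^ 2) ∂μ := by
    intro s j hs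
    have hm : Measurable fun z =>
        ENNReal.ofReal (∑ i, (e z i - if j = i then s * τ else 0) ^ 2) := by
      refine (Finset.measurable_sum _ fun i _ => ?_).ennreal_ofReal
      exact (((measurable_pi_apply i).comp he).sub_const _).pow_const 2
    rw [lintegral_add_pi_gaussianReal (s • w j) hm]
    refine lintegral_congr fun z => ?_
    rw [ENNReal.ofReal_mul (Real.exp_pos _).le, dotProduct_smul, smul_dotProduct, dotProduct_smul]
    simp only [smul_eq_mul, ← mul_assoc, hs, one_mul]
    rfl
  have hsum : ∑ v : J × Bool, ∫⁻ z, ENNReal.ofReal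
        (∑ i, (e (z + signOf v.2 • w v.1) i - if v.1 = i then signOf v.2 * τ else 0) ^ 2) ∂μ =
      ∫⁻ z, ENNReal.ofReal (∑ j, (P j z * ∑ i, (e z i - if j = i then τ else 0) ^ 2 +
        M j z * ∑ i, (e z i - if j = i then -τ else 0) ^ 2)) ∂μ := by
    have hem : ∀ (j : J) (c : ℝ), Measurable fun z => ∑ i, (e z i - if j = i then c else 0) ^ 2 :=
      fun j c => Finset.measurable_sum _ fun i _ =>
        (((measurable_pi_apply i).comp he).sub_const _).pow_const 2
    simp only [hshift _ _ (signOf_mul_self _)]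
    rw [Fintype.sum_prod_type]
    simp only [Fintype.sum_bool, signOf, if_true,
      Bool.false_eq_true, if_false, one_smul, neg_smul, one_mul, neg_mul]
    have hnn : ∀ j z, 0 ≤ P j z * ∑ i, (e z i - if j = i then τ else 0) ^ 2 := fun j z =>
      mul_nonneg (Real.exp_pos _).le (Finset.sum_nonneg fun i _ => sq_nonneg _)
    have hnn' : ∀ j z, 0 ≤ M j z * ∑ i, (e z i - if j = i then -τ else 0) ^ 2 := fun j z =>
      mul_nonneg (Real.exp_pos _).le (Finset.sum_nonneg fun i _ => sq_nonneg _)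
    simp only [ENNReal.ofReal_sum_of_nonneg fun j _ => add_nonneg (hnn j _) (hnn' j _),
      ENNReal.ofReal_add (hnn _ _) (hnn' _ _)]
    have hm1 : ∀ j, Measurable fun z =>
        ENNReal.ofReal (P j z * ∑ i, (e z i - if j = i then τ else 0) ^ 2) :=
      fun j => ((hPm j).mul (hem j τ)).ennreal_ofReal
    have hm2 : ∀ j, Measurable fun z =>
        ENNReal.ofReal (M j z * ∑ i, (e z i - if j = i then -τ else 0) ^ 2) :=
      fun j => ((hMm j).mul (hem j (-τ))).ennreal_ofReal
    rw [lintegral_finsetSum _ fun j _ => by exact (hm1 j).add (hm2 j)]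
    exact Finset.sum_congr rfl fun j _ => (lintegral_add_left (hm1 j) _).symm
  have hP : ∀ j, Integrable (P j) μ ∧ ∫ z, P j z ∂μ = 1 := fun j => integral_likelihoodRatio (w j)
  have hM : ∀ j, Integrable (M j) μ ∧ ∫ z, M j z ∂μ = 1 := fun j => by
    have := integral_likelihoodRatio (-w j)
    simpa only [neg_dotProduct_neg] using this
  have hD : ∀ j, Integrable (fun z => (P j z - M j z) ^ 2) μ ∧
      ∫ z, (P j z - M j z) ^ 2 ∂μ = 4 * Real.sinh (u j) :=
    fun j => integral_likelihoodRatio_sub_sq (w j)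
  have iPM : ∀ j, Integrable (fun z => P j z + M j z) μ := fun j => (hP j).1.add (hM j).1
  have iF : Integrable (fun z => τ ^ 2 * ∑ j, (P j z + M j z)) μ :=
    (integrable_finsetSum _ fun j _ => iPM j).const_mul _
  have iD : Integrable (fun z => B * τ ^ 2 * ∑ j, (P j z - M j z) ^ 2) μ :=
    (integrable_finsetSum _ fun j _ => (hD j).1).const_mul _
  have hint : ∫ z, h z ∂μ = 2 * m * τ ^ 2 - B * τ ^ 2 * (4 * ∑ j, Real.sinh (u j)) := by
    simp only [hh]
    rw [integral_sub iF iD, integral_const_mul, integral_const_mul,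
      integral_finsetSum _ fun j _ => (hD j).1,
      integral_finsetSum _ fun j _ => iPM j]
    have : ∀ j, ∫ z, (P j z + M j z) ∂μ = 2 := fun j => by
      rw [integral_add (hP j).1 (hM j).1, (hP j).2, (hM j).2]; norm_num
    simp only [this, (hD _).2, Finset.sum_const, Finset.card_univ, nsmul_eq_mul,
      ← Finset.mul_sum, ← hm]
    ring
  have hle : 2 * m * τ ^ 2 - 2 * τ ^ 2 / m * ∑ j, Real.sinh (u j) * Real.exp (u j / 2) ≤
      ∫ z, h z ∂μ := by
    rw [hint, hB]
    have h1 := sum_sinh_mul_sum_exp_le u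
    rw [← hm] at h1
    have h2 : (∑ j, Real.exp (u j / 2)) / (2 * m ^ 2) * τ ^ 2 * (4 * ∑ j, Real.sinh (u j)) =
        2 * τ ^ 2 / m ^ 2 * ((∑ j, Real.sinh (u j)) * ∑ j, Real.exp (u j / 2)) := by
      field_simp; ring
    have h3 : 2 * τ ^ 2 / m * ∑ j, Real.sinh (u j) * Real.exp (u j / 2) =
        2 * τ ^ 2 / m ^ 2 * (m * ∑ j, Real.sinh (u j) * Real.exp (u j / 2)) := by
      field_simp
    rw [h2, h3]
    gcongr
  refine (ENNReal.ofReal_le_ofReal hle).trans ?_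
  rw [hsum]
  refine (ofReal_integral_le_lintegral_ofReal h).trans ?_
  refine lintegral_mono fun z => ENNReal.ofReal_le_ofReal ?_
  have hF : 2 * ∑ j, Real.exp (-(u j / 2)) ≤ ∑ j, (P j z + M j z) := by
    rw [Finset.mul_sum]
    refine Finset.sum_le_sum fun j _ => ?_
    simp only [P, M, sub_eq_add_neg, Real.exp_add, dotProduct_neg, ← add_mul]
    gcongr
    have := Real.one_le_cosh (z ⬝ᵥ w j)
    rw [Real.cosh_eq] at this
    linarith
  have hFpos : 0 < ∑ j, (P j z + M j z) :=
    Finset.sum_pos (fun j _ => add_pos (Real.exp_pos _) (Real.exp_pos _)) Finset.univ_nonempty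
  refine le_sum_weighted_sq (fun j => P j z) (fun j => M j z) (e z) hFpos ?_
  have h1 := sq_card_le_sum_exp_neg_mul_sum_exp u
  rw [← hm] at h1
  rw [hB, div_mul_eq_mul_div, le_div_iff₀ (by positivity), one_mul]
  have h2 : 0 ≤ ∑ j, Real.exp (u j / 2) := Finset.sum_nonneg fun j _ => (Real.exp_pos _).le
  nlinarith [mul_le_mul_of_nonneg_left hF h2]

end Block

/-! ### Averaging the block bound over the Gaussian design. -/

section DesignAverage

variable {n p : ℕ}

lemma measurePreserving_column (j : Fin p) :
    MeasurePreserving (fun (X : Fin n → Fin p → ℝ) i => X i j) (designLaw n p)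
      (Measure.pi fun _ : Fin n => gaussianReal 0 ((n : ℝ≥0)⁻¹)) := by
  have hmap : ∀ _ : Fin n, (rowLaw n p).map (fun x : Fin p → ℝ => x j) =
      gaussianReal 0 ((n : ℝ≥0)⁻¹) :=
    fun _ => (measurePreserving_eval (fun _ : Fin p => gaussianReal 0 ((n : ℝ≥0)⁻¹)) j).map_eq
  have : ∀ i : Fin n, SigmaFinite ((rowLaw n p).map (fun x : Fin p → ℝ => x j)) := fun i => by
    rw [hmap i]; infer_instance
  refine ⟨by fun_prop, ?_⟩
  have h := Measure.pi_map_pi (μ := fun _ : Fin n => rowLaw n p)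
    (f := fun _ (x : Fin p → ℝ) => x j) (fun i => (measurable_pi_apply j).aemeasurable)
  rw [designLaw, h]
  congr 1
  exact funext hmap

lemma integral_exp_mul_column_sq (hn : n ≠ 0) (j : Fin p) {t : ℝ} (ht : 2 * t / n < 1) :
    Integrable (fun X : Fin n → Fin p → ℝ =>
      Real.exp (t * ((fun i => X i j) ⬝ᵥ fun i => X i j))) (designLaw n p) ∧
    ∫ X : Fin n → Fin p → ℝ, Real.exp (t * ((fun i => X i j) ⬝ᵥ fun i => X i j)) ∂designLaw n p =
      (√(1 - 2 * t / n))⁻¹ ^ n := by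
  have hv : (n : ℝ≥0)⁻¹ ≠ 0 := inv_ne_zero (by exact_mod_cast hn)
  have hc : ((((n : ℝ≥0)⁻¹ : ℝ≥0)) : ℝ) = (n : ℝ)⁻¹ := by simp
  obtain ⟨h1, h2⟩ := integral_exp_mul_sq_sum_pi_gaussianReal (ι := Fin n) hv (t := t)
    (by rwa [hc, ← div_eq_mul_inv])
  have hmp := measurePreserving_column (n := n) j
  refine ⟨hmp.integrable_comp_of_integrable h1, ?_⟩
  rw [hc, ← div_eq_mul_inv, Fintype.card_fin, ← hmp.map_eq,
    integral_map hmp.aemeasurable (Measurable.aestronglyMeasurable (by fun_prop))] at h2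
  exact h2

/-- The bound on the information carried by one coordinate at signal-to-noise ratio `r`. -/
noncomputable def infoBound (r : ℝ) : ℝ :=
  (Real.exp (3 / 2 * r / (1 - 3 * r)) - Real.exp (-(r / 2))) / 2

/-- Uses `1/(1 - x) = 1 + x/(1 - x) ≤ exp(x/(1 - x))`. Together with the next lemma it makes the
chi-square moments uniform in `n`. -/
lemma inv_sqrt_one_sub_pow_le {x c : ℝ} (hx0 : 0 ≤ x) (n : ℕ) (hc1 : n * x ≤ c) (hc : c < 1)
    (hn : n ≠ 0) : (√(1 - x))⁻¹ ^ n ≤ Real.exp (c / (1 - c) / 2) := by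
  have hn1 : (1 : ℝ) ≤ n := by exact_mod_cast Nat.one_le_iff_ne_zero.mpr hn
  have hxc : x ≤ c := by nlinarith
  have h1x : 0 < 1 - x := by linarith
  have h : (√(1 - x))⁻¹ ≤ Real.exp (x / (1 - x) / 2) := by
    rw [← Real.sqrt_inv, Real.exp_half]
    refine Real.sqrt_le_sqrt ?_
    have := Real.add_one_le_exp (x / (1 - x))
    refine le_trans (le_of_eq ?_) this
    field_simp; ring
  calc (√(1 - x))⁻¹ ^ n ≤ Real.exp (x / (1 - x) / 2) ^ n := by gcongr
    _ = Real.exp (n * x / (1 - x) / 2) := by rw [← Real.exp_nat_mul]; congr 1; ring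
    _ ≤ Real.exp (c / (1 - c) / 2) := by
      have h1 : n * x / (1 - x) ≤ c / (1 - c) := by
        apply div_le_div₀ (by nlinarith) hc1 (by linarith) (by linarith)
      gcongr

lemma exp_neg_le_inv_sqrt_one_add_pow {x : ℝ} (hx0 : 0 ≤ x) (n : ℕ) :
    Real.exp (-(n * x / 2)) ≤ (√(1 + x))⁻¹ ^ n := by
  have h : Real.exp (-(x / 2)) ≤ (√(1 + x))⁻¹ := by
    rw [Real.exp_neg, Real.exp_half]
    have := Real.add_one_le_exp x
    gcongr
    linarith
  calc Real.exp (-(n * x / 2)) = Real.exp (-(x / 2)) ^ n := by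
        rw [← Real.exp_nat_mul]; congr 1; ring
    _ ≤ _ := by gcongr

/-- `sinh u · exp(u/2) = (exp(3u/2) - exp(-u/2))/2` is a difference of two chi-square exponential
moments; the exponent `3/2` forces `3r < 1`. -/
lemma integral_sinh_mul_exp_column_le (hn : n ≠ 0) (j : Fin p) {r : ℝ} (hr0 : 0 ≤ r)
    (hr : 3 * r < 1) :
    Integrable (fun X : Fin n → Fin p → ℝ =>
      Real.sinh (r * ((fun i => X i j) ⬝ᵥ fun i => X i j)) *
        Real.exp (r * ((fun i => X i j) ⬝ᵥ fun i => X i j) / 2)) (designLaw n p) ∧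
    ∫ X : Fin n → Fin p → ℝ, Real.sinh (r * ((fun i => X i j) ⬝ᵥ fun i => X i j)) *
        Real.exp (r * ((fun i => X i j) ⬝ᵥ fun i => X i j) / 2) ∂designLaw n p ≤ infoBound r := by
  have hn1 : (1 : ℝ) ≤ n := by exact_mod_cast Nat.one_le_iff_ne_zero.mpr hn
  have hx : 2 * (3 / 2 * r) / n = 3 * r / n := by ring
  have hx' : 2 * (-(1 / 2) * r) / n = -(r / n) := by ring
  have hlt : 3 * r / n < 1 := by
    rw [div_lt_one (by linarith)]; linarith
  have hrn : 0 ≤ r / n := by positivity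
  obtain ⟨i1, e1⟩ := integral_exp_mul_column_sq hn j (t := 3 / 2 * r) (by rw [hx]; exact hlt)
  obtain ⟨i2, e2⟩ := integral_exp_mul_column_sq hn j (t := -(1 / 2) * r) (by rw [hx']; linarith)
  have h : ∀ s : ℝ, Real.sinh (r * s) * Real.exp (r * s / 2) =
      (Real.exp (3 / 2 * r * s) - Real.exp (-(1 / 2) * r * s)) / 2 := by
    intro s
    rw [Real.sinh_eq, div_mul_eq_mul_div, sub_mul, ← Real.exp_add, ← Real.exp_add]
    congr 3 <;> ring_nf
  simp only [h]
  refine ⟨(i1.sub i2).div_const 2, ?_⟩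
  rw [integral_div, integral_sub i1 i2, e1, e2, hx, hx', infoBound, sub_neg_eq_add]
  have b1 := inv_sqrt_one_sub_pow_le (x := 3 * r / n) (c := 3 * r) (by positivity) n
    (le_of_eq (by field_simp)) hr hn
  have b2 := exp_neg_le_inv_sqrt_one_add_pow hrn n
  have c1 : 3 * r / (1 - 3 * r) / 2 = 3 / 2 * r / (1 - 3 * r) := by ring
  have c2 : n * (r / n) / 2 = r / 2 := by field_simp
  rw [c1] at b1
  rw [c2] at b2
  gcongr

/-- Bayes risk lower bound for the coordinates `φ j` of one block, the other coordinates of the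
regression vector being fixed. -/
lemma block_risk_ge (hn : n ≠ 0) {m : ℕ} (hm : m ≠ 0) (φ : Fin m → Fin p) {τ σ : ℝ} (hσ : σ ≠ 0)
    (hr : 3 * (τ / σ) ^ 2 < 1) {est : Estimator n p} (hest : Measurable est)
    (β : EuclideanSpace ℝ (Fin p)) :
    ENNReal.ofReal (2 * m * τ ^ 2 - 2 * τ ^ 2 * infoBound ((τ / σ) ^ 2)) ≤
      ∑ v : Fin m × Bool, ∫⁻ X, ∫⁻ z, ENNReal.ofReal (∑ i,
        ((est (X, response σ (β + (signOf v.2 * τ) • EuclideanSpace.single (φ v.1) 1) X z)).ofLp (φ i)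
          - if v.1 = i then signOf v.2 * τ else 0) ^ 2) ∂noiseLaw n ∂designLaw n p := by
  set r := (τ / σ) ^ 2 with hrdef
  have hr0 : 0 ≤ r := sq_nonneg _
  have : Nonempty (Fin m) := Fin.pos_iff_nonempty.mp (Nat.pos_of_ne_zero hm)
  have hm' : (0 : ℝ) < m := by exact_mod_cast Nat.pos_of_ne_zero hm
  -- Adding `±τ` to coordinate `φ j` of the signal is the same as shifting the noise by `±(τ/σ)`
  -- times that column.
  let w : (Fin n → Fin p → ℝ) → Fin m → Fin n → ℝ := fun X j i => τ / σ * X i (φ j)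
  have hresp : ∀ (v : Fin m × Bool) (X : Fin n → Fin p → ℝ) (z : Fin n → ℝ),
      response σ (β + (signOf v.2 * τ) • EuclideanSpace.single (φ v.1) 1) X z =
        response σ β X (z + signOf v.2 • w X v.1) := by
    intro v X z
    ext i
    simp only [response, WithLp.ofLp_add, WithLp.ofLp_smul, PiLp.ofLp_single,
      dotProduct_add, dotProduct_smul, dotProduct_single, Pi.add_apply, Pi.smul_apply, smul_eq_mul,
      mul_one, w]
    field_simp
    ring
  simp only [hresp]
  rw [← lintegral_finsetSum]
  · have hX : ∀ X : Fin n → Fin p → ℝ, ENNReal.ofReal (2 * m * τ ^ 2 - 2 * τ ^ 2 / m *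
        ∑ j, Real.sinh (w X j ⬝ᵥ w X j) * Real.exp (w X j ⬝ᵥ w X j / 2)) ≤
        ∑ v : Fin m × Bool, ∫⁻ z, ENNReal.ofReal (∑ i,
        ((est (X, response σ β X (z + signOf v.2 • w X v.1))).ofLp (φ i)
          - if v.1 = i then signOf v.2 * τ else 0) ^ 2) ∂noiseLaw n := by
      intro X
      have hem : Measurable fun (z : Fin n → ℝ) (i : Fin m) =>
          (est (X, response σ β X z)).ofLp (φ i) := by
        have h1 : Measurable fun z : Fin n → ℝ => (X, response σ β X z) := by
          unfold response; fun_prop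
        have h2 : Measurable fun z : Fin n → ℝ => (est (X, response σ β X z)).ofLp :=
          (WithLp.measurable_ofLp 2 _).comp (hest.comp h1)
        exact measurable_pi_lambda _ fun i => (measurable_pi_apply (φ i)).comp h2
      have := block_bayesRisk_ge (w X) τ hem
      simpa only [Fintype.card_fin, noiseLaw] using this
    refine le_trans ?_ (lintegral_mono hX)
    refine le_trans (ENNReal.ofReal_le_ofReal ?_) (ofReal_integral_le_lintegral_ofReal _)
    have hw : ∀ X j, w X j ⬝ᵥ w X j = r * ((fun i => X i (φ j)) ⬝ᵥ fun i => X i (φ j)) := by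
      intro X j
      simp only [w, dotProduct, Finset.mul_sum, hrdef]
      exact Finset.sum_congr rfl fun i _ => by ring
    simp only [hw]
    have hI := fun j => integral_sinh_mul_exp_column_le hn (φ j) hr0 hr
    rw [integral_sub (integrable_const _)
      ((integrable_finsetSum _ fun j _ => (hI j).1).const_mul _),
      integral_const_mul (2 * τ ^ 2 / m), integral_finsetSum _ fun j _ => (hI j).1]
    have hsum := Finset.sum_le_sum fun j (_ : j ∈ (Finset.univ : Finset (Fin m))) => (hI j).2
    simp only [Finset.sum_const, Finset.card_univ, Fintype.card_fin, nsmul_eq_mul] at hsum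
    have h1 := mul_le_mul_of_nonneg_left hsum (show 0 ≤ 2 * τ ^ 2 / m by positivity)
    have h2 : 2 * τ ^ 2 / m * (m * infoBound r) = 2 * τ ^ 2 * infoBound r := by field_simp
    rw [h2] at h1
    simp only [integral_const, probReal_univ, one_smul]
    linarith
  · intro v _
    have hresp' : Measurable fun ω : (Fin n → Fin p → ℝ) × (Fin n → ℝ) =>
        response σ β ω.1 (ω.2 + signOf v.2 • w ω.1 v.1) := by
      have : Measurable fun ω : (Fin n → Fin p → ℝ) × (Fin n → ℝ) =>
          (ω.1, ω.2 + signOf v.2 • w ω.1 v.1) := by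
        simp only [w]
        fun_prop
      exact (measurable_response σ β).comp this
    have h2 : Measurable fun ω : (Fin n → Fin p → ℝ) × (Fin n → ℝ) =>
        (est (ω.1, response σ β ω.1 (ω.2 + signOf v.2 • w ω.1 v.1))).ofLp :=
      (WithLp.measurable_ofLp 2 _).comp (hest.comp (measurable_fst.prodMk hresp'))
    refine Measurable.lintegral_prod_right' (f := fun ω : (Fin n → Fin p → ℝ) × (Fin n → ℝ) =>
      ENNReal.ofReal (∑ i, ((est (ω.1, response σ β ω.1 (ω.2 + signOf v.2 • w ω.1 v.1))).ofLp (φ i)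
          - if v.1 = i then signOf v.2 * τ else 0) ^ 2)) ?_
    exact (Finset.measurable_sum _ fun i _ =>
      (((measurable_pi_apply (φ i)).comp h2).sub_const _).pow_const 2).ennreal_ofReal

end DesignAverage

/-! ### The block prior, and bounds on minimax and ridge risk. -/

section Minimax

variable {n p k m : ℕ}

/-- The `k`-sparse vector with one entry `±τ` in each of `k` blocks of length `m`. -/
noncomputable def blockVec (φ : Fin k × Fin m ↪ Fin p) (τ : ℝ) (c : Fin k → Fin m × Bool) :
    EuclideanSpace ℝ (Fin p) :=
  ∑ l, (signOf (c l).2 * τ) • EuclideanSpace.single (φ (l, (c l).1)) 1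

lemma blockVec_apply (φ : Fin k × Fin m ↪ Fin p) (τ : ℝ) (c : Fin k → Fin m × Bool) (i : Fin p) :
    (blockVec φ τ c).ofLp i =
      ∑ l, if i = φ (l, (c l).1) then signOf (c l).2 * τ else 0 := by
  simp only [blockVec, WithLp.ofLp_sum, Finset.sum_apply, WithLp.ofLp_smul, Pi.smul_apply,
    PiLp.ofLp_single, Pi.single_apply, smul_eq_mul, mul_ite, mul_one, mul_zero]

lemma blockVec_apply_embedding (φ : Fin k × Fin m ↪ Fin p) (τ : ℝ) (c : Fin k → Fin m × Bool)
    (l : Fin k) (j : Fin m) :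
    (blockVec φ τ c).ofLp (φ (l, j)) = if (c l).1 = j then signOf (c l).2 * τ else 0 := by
  rw [blockVec_apply, Finset.sum_eq_single l]
  · simp [eq_comm]
  · intro l' _ hl
    simp [hl.symm]
  · simp

lemma blockVec_mem_paramSpace (φ : Fin k × Fin m ↪ Fin p) (τ : ℝ) (c : Fin k → Fin m × Bool) :
    blockVec φ τ c ∈ paramSpace p k τ := by
  constructor
  · have hsub : (Finset.univ.filter fun i => (blockVec φ τ c).ofLp i ≠ 0) ⊆
        Finset.univ.image fun l => φ (l, (c l).1) := by
      intro i hi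
      simp only [Finset.mem_filter, Finset.mem_univ, true_and, blockVec_apply] at hi
      obtain ⟨l, _, hl⟩ := Finset.exists_ne_zero_of_sum_ne_zero hi
      simp only [Finset.mem_image, Finset.mem_univ, true_and]
      exact ⟨l, by by_contra h; exact hl (if_neg fun h' => h h'.symm)⟩
    refine (Finset.card_le_card hsub).trans ?_
    exact Finset.card_image_le.trans (by simp)
  · have h : ‖blockVec φ τ c‖ ^ 2 = ∑ l, (signOf (c l).2 * τ) * (signOf (c l).2 * τ) := by
      rw [← real_inner_self_eq_norm_sq]
      conv_lhs => rw [show inner ℝ (blockVec φ τ c) (blockVec φ τ c) =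
        inner ℝ (∑ l, (signOf (c l).2 * τ) • EuclideanSpace.single (φ (l, (c l).1)) 1)
          (blockVec φ τ c) from rfl]
      rw [sum_inner]
      refine Finset.sum_congr rfl fun l _ => ?_
      rw [real_inner_smul_left, EuclideanSpace.inner_single_left, blockVec_apply_embedding]
      simp
    have h2 : ∀ l, (signOf (c l).2 * τ) * (signOf (c l).2 * τ) = τ ^ 2 := fun l => by
      rw [mul_mul_mul_comm, signOf_mul_self]; ring
    rw [h]
    simp [h2]

lemma blockVec_update (φ : Fin k × Fin m ↪ Fin p) (τ : ℝ) (c : Fin k → Fin m × Bool) (l : Fin k)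
    (v : Fin m × Bool) :
    blockVec φ τ (Function.update c l v) =
      ∑ l' ∈ Finset.univ.erase l,
        (signOf (c l').2 * τ) • EuclideanSpace.single (φ (l', (c l').1)) 1 +
      (signOf v.2 * τ) • EuclideanSpace.single (φ (l, v.1)) 1 := by
  rw [blockVec, ← Finset.sum_erase_add _ _ (Finset.mem_univ l), Function.update_self]
  congr 1
  refine Finset.sum_congr rfl fun l' hl' => ?_
  rw [Function.update_of_ne (Finset.ne_of_mem_erase hl')]

/-- Resampling one coordinate preserves the uniform prior: exchanging the old value with the new one
is an involution. -/
lemma sum_sum_update {α V M : Type*} [Fintype α] [DecidableEq α] [Fintype V] [AddCommMonoid M]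
    (f : (α → V) → M) (l : α) :
    ∑ c : α → V, ∑ v, f (Function.update c l v) = Fintype.card V • ∑ c, f c := by
  have hinv : Function.Involutive
      fun x : (α → V) × V => (Function.update x.1 l x.2, x.1 l) := by
    intro x; simp
  rw [← Fintype.sum_prod_type' (f := fun c v => f (Function.update c l v)),
    Fintype.sum_equiv hinv.toPerm (fun x => f (Function.update x.1 l x.2)) (fun x => f x.1)
      (fun x => rfl), Fintype.sum_prod_type]
  simp [Finset.smul_sum]

lemma sum_block_loss_le (φ : Fin k × Fin m ↪ Fin p) (τ : ℝ) (c : Fin k → Fin m × Bool)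
    (b : EuclideanSpace ℝ (Fin p)) :
    ∑ l, ∑ i, (b.ofLp (φ (l, i)) - if (c l).1 = i then signOf (c l).2 * τ else 0) ^ 2 ≤
      ‖b - blockVec φ τ c‖ ^ 2 := by
  simp only [← blockVec_apply_embedding φ τ c]
  rw [EuclideanSpace.real_norm_sq_eq, ← Fintype.sum_prod_type'
    (f := fun l i => (b.ofLp (φ (l, i)) - (blockVec φ τ c).ofLp (φ (l, i))) ^ 2)]
  simp only [Prod.mk.eta]
  rw [← Finset.sum_map Finset.univ φ fun i => (b.ofLp i - (blockVec φ τ c).ofLp i) ^ 2]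
  exact Finset.sum_le_univ_sum_of_nonneg fun i => sq_nonneg _

lemma supRisk_ge (hn : n ≠ 0) (hm : m ≠ 0) (φ : Fin k × Fin m ↪ Fin p) {τ σ : ℝ} (hσ : σ ≠ 0)
    (hr : 3 * (τ / σ) ^ 2 < 1) {est : Estimator n p} (hest : Measurable est) :
    ENNReal.ofReal (k * τ ^ 2 * (1 - infoBound ((τ / σ) ^ 2) / m)) ≤ supRisk k τ σ est := by
  set b : ℝ≥0∞ := ENNReal.ofReal (2 * m * τ ^ 2 - 2 * τ ^ 2 * infoBound ((τ / σ) ^ 2)) with hb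
  have hm' : (0 : ℝ) < m := by exact_mod_cast Nat.pos_of_ne_zero hm
  have : Nonempty (Fin m) := Fin.pos_iff_nonempty.mp (Nat.pos_of_ne_zero hm)
  let g : Fin k → (Fin k → Fin m × Bool) → (Fin n → Fin p → ℝ) × (Fin n → ℝ) → ℝ≥0∞ :=
    fun l c ω => ENNReal.ofReal (∑ i,
      ((est (ω.1, response σ (blockVec φ τ c) ω.1 ω.2)).ofLp (φ (l, i)) -
        if (c l).1 = i then signOf (c l).2 * τ else 0) ^ 2)
  have hgm : ∀ l c, Measurable (g l c) := by
    intro l c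
    have h2 : Measurable fun ω : (Fin n → Fin p → ℝ) × (Fin n → ℝ) =>
        (est (ω.1, response σ (blockVec φ τ c) ω.1 ω.2)).ofLp :=
      (WithLp.measurable_ofLp 2 _).comp (hest.comp (measurable_fst.prodMk
        (measurable_response σ _)))
    exact (Finset.measurable_sum _ fun i _ =>
      (((measurable_pi_apply (φ (l, i))).comp h2).sub_const _).pow_const 2).ennreal_ofReal
  set Q := (designLaw n p).prod (noiseLaw n) with hQ
  have h1 : ∀ c, ∑ l, ∫⁻ ω, g l c ω ∂Q ≤ supRisk k τ σ est := by
    intro c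
    rw [← lintegral_finsetSum _ fun l _ => hgm l c]
    have h2 : risk σ est (blockVec φ τ c) ≤ supRisk k τ σ est :=
      le_iSup₂ (f := fun β (_ : β ∈ paramSpace p k τ) => risk σ est β) _
        (blockVec_mem_paramSpace φ τ c)
    refine le_trans (lintegral_mono fun ω => ?_) h2
    simp only [g]
    rw [← ENNReal.ofReal_sum_of_nonneg fun l _ => Finset.sum_nonneg fun i _ => sq_nonneg _,
      ← ofReal_norm, ← ENNReal.ofReal_pow (norm_nonneg _)]
    exact ENNReal.ofReal_le_ofReal (sum_block_loss_le φ τ c _)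
  -- The other `k - 1` blocks are frozen, as if an oracle revealed them; the one-block bound allows
  -- an arbitrary fixed background.
  have h2 : ∀ l c, b ≤ ∑ v, ∫⁻ ω, g l (Function.update c l v) ω ∂Q := by
    intro l c
    have h := block_risk_ge hn hm (fun i => φ (l, i)) hσ hr hest
      (∑ l' ∈ Finset.univ.erase l,
        (signOf (c l').2 * τ) • EuclideanSpace.single (φ (l', (c l').1)) 1)
    refine h.trans_eq (Finset.sum_congr rfl fun v _ => ?_)
    rw [lintegral_prod _ (hgm _ _).aemeasurable]
    simp only [g, blockVec_update, Function.update_self]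
  have h3 : ∀ l, Fintype.card (Fin k → Fin m × Bool) • b ≤
      (2 * m) • ∑ c, ∫⁻ ω, g l c ω ∂Q := by
    intro l
    have h := sum_sum_update (fun c => ∫⁻ ω, g l c ω ∂Q) l
    rw [show Fintype.card (Fin m × Bool) = 2 * m by simp [mul_comm]] at h
    rw [← h, ← Finset.card_univ, ← Finset.sum_const]
    exact Finset.sum_le_sum fun c _ => h2 l c
  have hN : (Fintype.card (Fin k → Fin m × Bool) : ℝ≥0∞) ≠ 0 := by
    exact_mod_cast Fintype.card_ne_zero
  have h4 : Fintype.card (Fin k → Fin m × Bool) • (k • b) ≤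
      Fintype.card (Fin k → Fin m × Bool) • ((2 * m) • supRisk k τ σ est) := by
    calc Fintype.card (Fin k → Fin m × Bool) • (k • b)
        = ∑ _l : Fin k, Fintype.card (Fin k → Fin m × Bool) • b := by
          rw [Finset.sum_const, Finset.card_univ, Fintype.card_fin, smul_comm]
      _ ≤ ∑ l : Fin k, (2 * m) • ∑ c, ∫⁻ ω, g l c ω ∂Q := Finset.sum_le_sum fun l _ => h3 l
      _ = (2 * m) • ∑ c, ∑ l, ∫⁻ ω, g l c ω ∂Q := by
          rw [← Finset.smul_sum, Finset.sum_comm]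
      _ ≤ (2 * m) • ∑ _c : Fin k → Fin m × Bool, supRisk k τ σ est := by
          gcongr with c; exact h1 c
      _ = _ := by rw [Finset.sum_const, Finset.card_univ, smul_comm]
  rw [nsmul_eq_mul _ (k • b), nsmul_eq_mul _ ((2 * m) • _)] at h4
  have h5 := (ENNReal.mul_le_mul_iff_right hN (ENNReal.natCast_ne_top _)).mp h4
  rw [nsmul_eq_mul, nsmul_eq_mul] at h5
  have h6 : ((2 * m : ℕ) : ℝ≥0∞) * ENNReal.ofReal (k * τ ^ 2 * (1 - infoBound ((τ / σ) ^ 2) / m)) =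
      k * b := by
    rw [hb, ← ENNReal.ofReal_natCast, ← ENNReal.ofReal_natCast,
      ← ENNReal.ofReal_mul (by positivity), ← ENNReal.ofReal_mul (by positivity)]
    congr 1
    push_cast
    field_simp
  rw [← h6] at h5
  have hm2 : ((2 * m : ℕ) : ℝ≥0∞) ≠ 0 := by exact_mod_cast (by omega)
  exact (ENNReal.mul_le_mul_iff_right hm2 (ENNReal.natCast_ne_top _)).mp h5

lemma snrMinimaxRisk_ge (hn : n ≠ 0) (hm : m ≠ 0) (hkm : k * m ≤ p) {τ σ : ℝ} (hσ : σ ≠ 0)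
    (hr : 3 * (τ / σ) ^ 2 < 1) :
    ENNReal.ofReal (k * τ ^ 2 * (1 - infoBound ((τ / σ) ^ 2) / m)) ≤
      snrMinimaxRisk n p k τ σ :=
  le_iInf₂ fun _ hest => supRisk_ge hn hm
    (finProdFinEquiv.toEmbedding.trans (Fin.castLEEmb hkm)) hσ hr hest

lemma snrMinimaxRisk_le_supRisk_ridgeEstimator (lam τ σ : ℝ) :
    snrMinimaxRisk n p k τ σ ≤ supRisk k τ σ (ridgeEstimator n p lam) :=
  iInf₂_le _ (measurable_ridgeEstimator lam)

lemma supRisk_ridgeEstimator_le (hn : n ≠ 0) (hp : p ≠ 0) (hk : k ≠ 0) {τ σ : ℝ} (hτ : 0 < τ)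
    (hσ : 0 < σ) :
    supRisk k τ σ (ridgeEstimator n p (p * σ ^ 2 / (k * τ ^ 2))) ≤
      ENNReal.ofReal (k * τ ^ 2 * (1 - k * τ ^ 2 / (p * σ ^ 2) *
        (1 - 3 * (k * τ ^ 2 / (p * σ ^ 2) + gaussianFourthMoment * (k / n * (τ / σ) ^ 2))))) := by
  have hn' : (0 : ℝ) < n := by exact_mod_cast Nat.pos_of_ne_zero hn
  have hp' : (0 : ℝ) < p := by exact_mod_cast Nat.pos_of_ne_zero hp
  have hk' : (0 : ℝ) < k := by exact_mod_cast Nat.pos_of_ne_zero hk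
  have hlam : 0 < p * σ ^ 2 / (k * τ ^ 2) := by positivity
  refine iSup₂_le fun β hβ => (risk_ridgeEstimator_le hn hlam σ β).trans
    (ENNReal.ofReal_le_ofReal ?_)
  have hK := gaussianFourthMoment_nonneg
  set K := gaussianFourthMoment
  set r := k * τ ^ 2 / (p * σ ^ 2) with hr
  have hrpos : 0 < r := by positivity
  have e1 : p * σ ^ 2 / (k * τ ^ 2) = r⁻¹ := by rw [hr, inv_div]
  have e2 : k / n * (τ / σ) ^ 2 = r * (p / n) := by rw [hr]; field_simp
  have e3 : σ ^ 2 * p * r = k * τ ^ 2 := by rw [hr]; field_simp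
  rw [e1, e2]
  have hq : 0 ≤ K * (p / n) := by positivity
  -- Nonnegativity of the coefficient of `‖β‖²` allows `‖β‖²` to be replaced by its maximum `kτ²`.
  have hcoef : 0 ≤ 1 - 2 / r⁻¹ + 3 / r⁻¹ ^ 2 * (1 + K * (p / n)) := by
    have : 1 - 2 / r⁻¹ + 3 / r⁻¹ ^ 2 * (1 + K * (p / n)) =
        (1 - r) ^ 2 + 2 * r ^ 2 + 3 * r ^ 2 * (K * (p / n)) := by field_simp; ring
    rw [this]; positivity
  have h1 := mul_le_mul_of_nonneg_left hβ.2 hcoef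
  refine (add_le_add_left h1 _).trans_eq ?_
  have e4 : σ ^ 2 / r⁻¹ ^ 2 * p = (σ ^ 2 * p * r) * r := by field_simp
  rw [e4, e3]
  field_simp
  ring

end Minimax

/-! ### From two-sided bounds to the expansion. -/

section Asymptotics

/-- The derivative at 0 is `(3/2 + 1/2)/2 = 1`, the sharp constant of the second-order term. -/
lemma tendsto_infoBound_div : Tendsto (fun r => infoBound r / r) (𝓝[≠] 0) (𝓝 1) := by
  have h : HasDerivAt infoBound 1 0 := by
    have h1 : HasDerivAt (fun r : ℝ => 3 / 2 * r / (1 - 3 * r)) (3 / 2) 0 := by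
      have ha : HasDerivAt (fun r : ℝ => 3 / 2 * r) (3 / 2) 0 := by
        simpa using (hasDerivAt_id (0 : ℝ)).const_mul (3 / 2)
      have hb : HasDerivAt (fun r : ℝ => 1 - 3 * r) (-3) 0 := by
        simpa using ((hasDerivAt_id (0 : ℝ)).const_mul 3).const_sub 1
      have h := ha.div hb (by norm_num)
      norm_num at h
      exact h
    have h2 : HasDerivAt (fun r : ℝ => -(r / 2)) (-(1 / 2)) 0 :=
      ((hasDerivAt_id (0 : ℝ)).div_const 2).neg
    have h3 := (h1.exp.sub h2.exp).div_const 2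
    norm_num at h3
    exact h3
  have h0 : infoBound 0 = 0 := by simp [infoBound]
  have := h.tendsto_slope
  refine this.congr' (Eventually.of_forall fun r => ?_)
  simp [slope_def_field, h0]

/-- Solving the expansion for `δ` squeezes it between `-e₂` and `e₁`. -/
lemma exists_expansion {R : ℕ → ℝ≥0∞} {L r e₁ e₂ : ℕ → ℝ} (hL : ∀ n, 0 < L n) (hr : ∀ n, 0 < r n)
    (hr0 : Tendsto r atTop (𝓝 0)) (h₁ : Tendsto e₁ atTop (𝓝 0)) (h₂ : Tendsto e₂ atTop (𝓝 0))
    (hlow : ∀ᶠ n in atTop, ENNReal.ofReal (L n * (1 - r n * (1 + e₁ n))) ≤ R n)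
    (hup : ∀ᶠ n in atTop, R n ≤ ENNReal.ofReal (L n * (1 - r n * (1 - e₂ n)))) :
    ∃ δ : ℕ → ℝ, Tendsto δ atTop (𝓝 0) ∧
      ∀ᶠ n in atTop, R n = ENNReal.ofReal (L n * (1 - r n * (1 + δ n))) := by
  refine ⟨fun n => (1 - (R n).toReal / L n) / r n - 1, ?_, ?_⟩
  -- The upper bound must be nonnegative, or `ENNReal.ofReal` would truncate it.
  · have hpos : ∀ᶠ n in atTop, r n * (1 - e₂ n) < 1 := by
      have : Tendsto (fun n => r n * (1 - e₂ n)) atTop (𝓝 0) := by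
        simpa using hr0.mul (h₂.const_sub 1)
      exact this.eventually_lt_const one_pos
    refine tendsto_of_tendsto_of_tendsto_of_le_of_le' (g := fun n => -e₂ n) (h := e₁)
      (by simpa using h₂.neg) h₁ ?_ ?_
    · filter_upwards [hup, hpos] with n hn hp
      have h := ENNReal.toReal_mono ENNReal.ofReal_ne_top hn
      rw [ENNReal.toReal_ofReal (mul_nonneg (hL n).le (by linarith)), mul_comm,
        ← div_le_iff₀ (hL n)] at h
      have : (1 - e₂ n) ≤ (1 - (R n).toReal / L n) / r n := by
        rw [le_div_iff₀ (hr n)]; linarith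
      linarith
    · filter_upwards [hlow, hup] with n hn hn'
      have hfin : R n ≠ ∞ := ne_top_of_le_ne_top ENNReal.ofReal_ne_top hn'
      have h := (ENNReal.ofReal_le_iff_le_toReal hfin).mp hn
      rw [mul_comm, ← le_div_iff₀ (hL n)] at h
      have : (1 - (R n).toReal / L n) / r n ≤ 1 + e₁ n := by
        rw [div_le_iff₀ (hr n)]; linarith
      linarith
  · filter_upwards [hup] with n hn
    have hfin : R n ≠ ∞ := ne_top_of_le_ne_top ENNReal.ofReal_ne_top hn
    have h1 := (hr n).ne'
    have h2 := (hL n).ne'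
    have : L n * (1 - r n * (1 + ((1 - (R n).toReal / L n) / r n - 1))) = (R n).toReal := by
      field_simp
      ring
    rw [this, ENNReal.ofReal_toReal hfin]

end Asymptotics

end SparseRegression

theorem mainTheorem3 (p k : ℕ → ℕ) (τ σ : ℕ → ℝ)
    (hp : ∀ n, 0 < p n) (hk : ∀ n, 0 < k n) (hτ : ∀ n, 0 < τ n) (hσ : ∀ n, 0 < σ n)
    (hkp : Tendsto (fun n => (k n : ℝ) / (p n : ℝ)) atTop (𝓝 0))
    (hkn : Tendsto (fun n => (k n : ℝ) / (n : ℝ)) atTop (𝓝 0))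
    (hτσ : Tendsto (fun n => τ n / σ n) atTop (𝓝 0)) :
    (∃ δ : ℕ → ℝ, Tendsto δ atTop (𝓝 0) ∧ ∀ᶠ n in atTop,
      SparseRegression.snrMinimaxRisk n (p n) (k n) (τ n) (σ n) =
        ENNReal.ofReal (k n * τ n ^ 2 *
          (1 - k n * τ n ^ 2 / (p n * σ n ^ 2) * (1 + δ n)))) ∧
    (∃ δ : ℕ → ℝ, Tendsto δ atTop (𝓝 0) ∧ ∀ᶠ n in atTop,
      (∃ est : SparseRegression.Estimator n (p n), Measurable est ∧
        SparseRegression.IsRidgeEstimator (p n * σ n ^ 2 / (k n * τ n ^ 2)) est) ∧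
      ∀ est : SparseRegression.Estimator n (p n),
        SparseRegression.IsRidgeEstimator (p n * σ n ^ 2 / (k n * τ n ^ 2)) est →
        SparseRegression.supRisk (k n) (τ n) (σ n) est =
          ENNReal.ofReal (k n * τ n ^ 2 *
            (1 - k n * τ n ^ 2 / (p n * σ n ^ 2) * (1 + δ n)))) := by
  have hp' : ∀ n, (0 : ℝ) < p n := fun n => by exact_mod_cast hp n
  have hk' : ∀ n, (0 : ℝ) < k n := fun n => by exact_mod_cast hk n
  have hlam : ∀ n, 0 < p n * σ n ^ 2 / (k n * τ n ^ 2) := fun n => by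
    have := hp' n; have := hk' n; have := hσ n; have := hτ n; positivity
  have hL : ∀ n, 0 < k n * τ n ^ 2 := fun n => by
    have := hk' n; have := hτ n; positivity
  have hr : ∀ n, 0 < k n * τ n ^ 2 / (p n * σ n ^ 2) := fun n => by
    have := hp' n; have := hk' n; have := hσ n; have := hτ n; positivity
  have ha : Tendsto (fun n => (τ n / σ n) ^ 2) atTop (𝓝 0) := by simpa using hτσ.pow 2
  have ha0 : ∀ n, 0 < (τ n / σ n) ^ 2 := fun n => by
    have := hσ n; have := hτ n; positivity
  have hreq : ∀ n, k n * τ n ^ 2 / (p n * σ n ^ 2) = k n / p n * (τ n / σ n) ^ 2 := fun n => by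
    rw [div_pow, div_mul_div_comm]
  have hr0 : Tendsto (fun n => k n * τ n ^ 2 / (p n * σ n ^ 2)) atTop (𝓝 0) := by
    simp only [hreq]
    simpa using hkp.mul ha
  have hx : Tendsto (fun n => (p n : ℝ) / k n) atTop atTop := by
    have h0 : Tendsto (fun n => (k n : ℝ) / p n) atTop (𝓝[>] 0) :=
      tendsto_nhdsWithin_iff.mpr ⟨hkp, Eventually.of_forall fun n => div_pos (hk' n) (hp' n)⟩
    have h : Tendsto (fun n => ((k n : ℝ) / p n)⁻¹) atTop atTop := h0.inv_tendsto_nhdsGT_zero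
    simpa only [inv_div] using h
  have hfl : Tendsto (fun n => ((p n / k n : ℕ) : ℝ) / ((p n : ℝ) / k n)) atTop (𝓝 1) := by
    have h := (tendsto_nat_floor_div_atTop (R := ℝ)).comp hx
    simpa only [Function.comp_def, Nat.floor_div_natCast, Nat.floor_natCast] using h
  -- Chosen so that `r(1 + e₁) = infoBound a / m` exactly, with `m = ⌊p/k⌋`; the second factor is
  -- the rounding loss.
  set e₁ : ℕ → ℝ := fun n => SparseRegression.infoBound ((τ n / σ n) ^ 2) / (τ n / σ n) ^ 2 *
    (((p n / k n : ℕ) : ℝ) / ((p n : ℝ) / k n))⁻¹ - 1 with he₁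
  set e₂ : ℕ → ℝ := fun n => 3 * (k n * τ n ^ 2 / (p n * σ n ^ 2) +
    SparseRegression.gaussianFourthMoment * (k n / n * (τ n / σ n) ^ 2)) with he₂
  have h₁ : Tendsto e₁ atTop (𝓝 0) := by
    have h : Tendsto (fun n => SparseRegression.infoBound ((τ n / σ n) ^ 2) / (τ n / σ n) ^ 2)
        atTop (𝓝 1) := SparseRegression.tendsto_infoBound_div.comp
      (tendsto_nhdsWithin_iff.mpr ⟨ha, Eventually.of_forall fun n => (ha0 n).ne'⟩)
    simpa [he₁] using (h.mul (hfl.inv₀ one_ne_zero)).sub_const 1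
  have h₂ : Tendsto e₂ atTop (𝓝 0) := by
    simpa using (hr0.add ((hkn.mul ha).const_mul SparseRegression.gaussianFourthMoment)).const_mul 3
  have hlow : ∀ᶠ n in atTop, ENNReal.ofReal (k n * τ n ^ 2 *
      (1 - k n * τ n ^ 2 / (p n * σ n ^ 2) * (1 + e₁ n))) ≤
        SparseRegression.snrMinimaxRisk n (p n) (k n) (τ n) (σ n) := by
    filter_upwards [eventually_ne_atTop 0, hkp.eventually_lt_const one_pos,
      (ha.const_mul 3).eventually_lt_const (show 3 * (0 : ℝ) < 1 by norm_num)] with n hn hkpn han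
    have hle : k n ≤ p n := by
      rw [div_lt_one (hp' n)] at hkpn
      exact_mod_cast hkpn.le
    have hm : p n / k n ≠ 0 := (Nat.div_pos hle (hk n)).ne'
    have hm' : ((p n / k n : ℕ) : ℝ) ≠ 0 := by exact_mod_cast hm
    have h := SparseRegression.snrMinimaxRisk_ge hn hm (Nat.mul_div_le (p n) (k n)) (hσ n).ne' han
    refine le_trans (le_of_eq ?_) h
    congr 3
    simp only [he₁, hreq]
    have h1 := (ha0 n).ne'
    have h2 := (hp' n).ne'
    have h3 := (hk' n).ne'
    generalize (τ n / σ n) ^ 2 = a at *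
    field_simp
    ring
  have hup : ∀ᶠ n in atTop, SparseRegression.supRisk (k n) (τ n) (σ n)
      (SparseRegression.ridgeEstimator n (p n) (p n * σ n ^ 2 / (k n * τ n ^ 2))) ≤
      ENNReal.ofReal (k n * τ n ^ 2 *
        (1 - k n * τ n ^ 2 / (p n * σ n ^ 2) * (1 - e₂ n))) := by
    filter_upwards [eventually_ne_atTop 0] with n hn
    exact SparseRegression.supRisk_ridgeEstimator_le hn (hp n).ne' (hk n).ne' (hτ n) (hσ n)
  have hmid : ∀ n, SparseRegression.snrMinimaxRisk n (p n) (k n) (τ n) (σ n) ≤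
      SparseRegression.supRisk (k n) (τ n) (σ n)
      (SparseRegression.ridgeEstimator n (p n) (p n * σ n ^ 2 / (k n * τ n ^ 2))) :=
    fun n => SparseRegression.snrMinimaxRisk_le_supRisk_ridgeEstimator _ _ _
  refine ⟨SparseRegression.exists_expansion hL hr hr0 h₁ h₂ hlow
    (hup.mono fun n hn => (hmid n).trans hn), ?_⟩
  obtain ⟨δ, hδ, hev⟩ := SparseRegression.exists_expansion hL hr hr0 h₁ h₂
    (hlow.mono fun n hn => hn.trans (hmid n)) hup
  refine ⟨δ, hδ, hev.mono fun n hn => ⟨⟨_, SparseRegression.measurable_ridgeEstimator _,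
    SparseRegression.isRidgeEstimator_ridgeEstimator (hlam n)⟩, fun est hest => ?_⟩⟩
  rw [hest.eq_ridgeEstimator (hlam n), hn]
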